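/- Fix an integer $k\ge 2$ and $\alpha\in\mathbb{C}$ with $|\alpha|<2$. For an integer $N\ge 2$ let $\mathfrak X_N^{(k)}$ be the finite set of all $k$-free positive integers whose prime factors do not exceed $N$, i.e. of all products $\prod_{p\le N}p^{\nu(p)}$ over primes with $0\le\nu(p)\le k-1$. Let $\Omega(x)$ be the number of prime factors of $x$ counted with multiplicity, put $Z_N=\sum_{x\in\mathfrak X_N^{(k)}}\alpha^{\Omega(x)}/x$, and $$\varphi_N(\lambda)=\frac1{Z_N}\sum_{x\in\mathfrak X_N^{(k)}}\frac{\alpha^{\Omega(x)}}{x}\,e^{i\lambda\frac{\log x}{\log N}},\qquad \varphi^{(\alpha)}(\lambda)=\exp\left\{\alpha\int_0^1\frac{e^{i\lambda v}-1}{v}\,dv\right\}\qquad(\lambda\in\mathbb{R}).$$ Let $\hat f$ denote the Fourier transform of $f$, in the sense of tempered distributions and normalized by $\hat f(\lambda)=\frac1{2\pi}\int_{\mathbb R} f(x)e^{-i\lambda x}\,dx$ for integrable $f$. For real $\eta$ let $\mathcal S_\eta(\mathbb{R})$ be the set of functions $f:\mathbb{R}\to\mathbb{C}$ whose Fourier transform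 is (represented by) a function for which there is $C>0$ with $|\hat f(\lambda)|\le C/(1+|\lambda|^\eta)$ for all $\lambda\in\mathbb{R}$. Proposition. Let $f\in\mathcal S_\eta(\mathbb{R})$ with $\eta\ge|\alpha|-\Re\alpha+1$. Then for every $R=R(N)$, positive for all large $N$, such that $$\frac{R}{\log N}\to0\quad\text{and}\quad\frac{(\log N)^{|\alpha|-\Re\alpha}}{R^{\eta-1}}\to0\quad\text{as }N\to\infty,$$ the integrals below converge absolutely and $$\int_{\mathbb{R}}\varphi_N(\lambda)\hat f(\lambda)\,d\lambda=\int_{|\lambda|\le R}\varphi^{(\alpha)}(\lambda)\hat f(\lambda)\,d\lambda+\varepsilon_N\qquad(N\ge2),$$ where $\varepsilon_N\to0$ as $N\to\infty$ and $$\varepsilon_N=O\!\left(\frac{\log\log N}{\log N}\right)+O\!\left(\frac{(\log N)^{|\alpha|-\Re\alpha}}{R^{\eta-1}}\right)\quad\text{as }N\to\infty.$$ The constants implied by the $O$-notation may depend on $k$, $\alpha$, $f$ and $R$. -/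

import Mathlib

open MeasureTheory Filter Topology Asymptotics
open scoped SchwartzMap

namespace SmoothSums

noncomputable section

/-- The set of all `k`-free integers whose prime factors do not exceed `N`, i.e. of all products
`∏_{p ≤ N} p ^ ν(p)` over the primes `p ≤ N` with exponents `0 ≤ ν(p) ≤ k - 1`. -/
def ensemble (k N : ℕ) : Finset ℕ :=
  (Fintype.piFinset fun _ : Nat.primesLE N => Finset.range k).image
    fun ν => ∏ p : Nat.primesLE N, (p : ℕ) ^ ν p

/-- The complex measure `X ↦ ∑_{x ∈ X} α ^ Ω(x) / x`. -/
def P (α : ℂ) (X : Finset ℕ) : ℂ :=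
  ∑ x ∈ X, α ^ ArithmeticFunction.cardFactors x / (x : ℂ)

/-- The partition function. -/
def Z (k : ℕ) (α : ℂ) (N : ℕ) : ℂ :=
  P α (ensemble k N)

/-- The normalized complex measure on `ensemble k N`. -/
def PN (k : ℕ) (α : ℂ) (N : ℕ) (X : Finset ℕ) : ℂ :=
  (Z k α N)⁻¹ * P α X

/-- The function `ξ_N(x) = log x / log N`. -/
def xi (N x : ℕ) : ℝ :=
  Real.log x / Real.log N

/-- The characteristic function `φ_N(l)` of `ξ_N` with respect to the normalized measure. -/
def phiN (k : ℕ) (α : ℂ) (N : ℕ) (l : ℝ) : ℂ :=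
  ∑ x ∈ ensemble k N, Complex.exp (Complex.I * l * xi N x) * PN k α N {x}

/-- The limiting characteristic function `exp (α ∫₀¹ (e ^ (i l v) - 1) / v dv)`. -/
def phi (α : ℂ) (l : ℝ) : ℂ :=
  Complex.exp (α * ∫ v in (0 : ℝ)..1, (Complex.exp (Complex.I * l * v) - 1) / v)

/-- The Fourier transform of an integrable function, normalized so that the inversion formula
reads `f(x) = ∫ f̂(l) e ^ (i l x) dl`. -/
def fourierTransform (f : ℝ → ℂ) (l : ℝ) : ℂ :=
  (1 / (2 * Real.pi) : ℝ) * ∫ x : ℝ, f x * Complex.exp (-(Complex.I * l * x))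

/-- `g` is the Fourier transform of `f`, both being tempered functions: `∫ g ψ = ∫ f ψ̂` for all
Schwartz functions `ψ`. This covers the integrable functions `f`
(see `hasFourierTransform_of_integrable`), and `g` is determined by `f` up to a null set
(see `HasFourierTransform.ae_eq`). -/
structure HasFourierTransform (f g : ℝ → ℂ) : Prop where
  integrable_left : ∀ ψ : 𝓢(ℝ, ℂ), Integrable fun x => f x * ψ x
  integrable_right : ∀ ψ : 𝓢(ℝ, ℂ), Integrable fun l => g l * ψ l
  integral_eq : ∀ ψ : 𝓢(ℝ, ℂ), ∫ l, g l * ψ l = ∫ x, f x * fourierTransform ψ x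

/-- The space of functions whose Fourier transform is at most `C / (1 + |l| ^ η)` for some `C`. -/
def S (η : ℝ) : Set (ℝ → ℂ) :=
  {f | ∃ g : ℝ → ℂ, HasFourierTransform f g ∧
    ∃ C : ℝ, 0 < C ∧ ∀ l : ℝ, ‖g l‖ ≤ C / (1 + |l| ^ η)}

theorem continuous_fourierTransform {f : ℝ → ℂ} (hf : Integrable f) :
    Continuous (fourierTransform f) := by
  unfold fourierTransform
  refine continuous_const.mul ?_
  refine continuous_of_dominated (bound := fun x => ‖f x‖) ?_ ?_ hf.norm ?_
  · intro l
    exact hf.1.mul (by fun_prop : Continuous fun x : ℝ =>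
      Complex.exp (-(Complex.I * l * x))).aestronglyMeasurable
  · intro l
    refine ae_of_all _ fun x => ?_
    have : -(Complex.I * l * x) = ((-(l * x) : ℝ) : ℂ) * Complex.I := by push_cast; ring
    rw [norm_mul, this, Complex.norm_exp_ofReal_mul_I, mul_one]
  · exact ae_of_all _ fun x => by fun_prop

theorem norm_fourierTransform_le (f : ℝ → ℂ) (l : ℝ) :
    ‖fourierTransform f l‖ ≤ (1 / (2 * Real.pi)) * ∫ x, ‖f x‖ := by
  unfold fourierTransform
  rw [norm_mul, Complex.norm_real, Real.norm_of_nonneg (by positivity)]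
  refine mul_le_mul_of_nonneg_left ?_ (by positivity)
  refine (norm_integral_le_integral_norm _).trans_eq (integral_congr_ae (ae_of_all _ fun x => ?_))
  have : -(Complex.I * l * x) = ((-(l * x) : ℝ) : ℂ) * Complex.I := by push_cast; ring
  simp only [norm_mul, this, Complex.norm_exp_ofReal_mul_I, mul_one]

theorem hasFourierTransform_of_integrable {f : ℝ → ℂ} (hf : Integrable f) :
    HasFourierTransform f (fourierTransform f) where
  integrable_left ψ :=
    hf.mul_bdd (c := SchwartzMap.seminorm ℝ 0 0 ψ) ψ.continuous.aestronglyMeasurable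
      (ae_of_all _ fun x => SchwartzMap.norm_le_seminorm ℝ ψ x)
  integrable_right ψ :=
    ψ.integrable.bdd_mul (continuous_fourierTransform hf).aestronglyMeasurable
      (ae_of_all _ fun x => norm_fourierTransform_le f x)
  integral_eq ψ := by
    have hint : Integrable (Function.uncurry fun l x : ℝ =>
        (ψ l * f x) * Complex.exp (-(Complex.I * l * x))) (volume.prod volume) := by
      refine (ψ.integrable.mul_prod hf).mul_bdd (c := 1) ?_ (ae_of_all _ fun p => ?_)
      · exact (by fun_prop : Continuous fun p : ℝ × ℝ =>
          Complex.exp (-(Complex.I * p.1 * p.2))).aestronglyMeasurable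
      · have : -(Complex.I * p.1 * p.2) = ((-(p.1 * p.2) : ℝ) : ℂ) * Complex.I := by
          push_cast; ring
        rw [this, Complex.norm_exp_ofReal_mul_I]
    have hswap := integral_integral_swap hint
    unfold fourierTransform
    have h1 : ∀ l : ℝ, ((1 / (2 * Real.pi) : ℝ) : ℂ) *
        (∫ x : ℝ, f x * Complex.exp (-(Complex.I * l * x))) * ψ l =
        ((1 / (2 * Real.pi) : ℝ) : ℂ) *
          ∫ x : ℝ, (ψ l * f x) * Complex.exp (-(Complex.I * l * x)) := by
      intro l
      simp_rw [mul_assoc (ψ l)]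
      rw [integral_const_mul]
      ring
    have h2 : ∀ x : ℝ, f x * (((1 / (2 * Real.pi) : ℝ) : ℂ) *
        (∫ l : ℝ, ψ l * Complex.exp (-(Complex.I * x * l)))) =
        ((1 / (2 * Real.pi) : ℝ) : ℂ) *
          ∫ l : ℝ, (ψ l * f x) * Complex.exp (-(Complex.I * l * x)) := by
      intro x
      have : ∀ l : ℝ, (ψ l * f x) * Complex.exp (-(Complex.I * l * x)) =
          f x * (ψ l * Complex.exp (-(Complex.I * x * l))) := by
        intro l
        rw [show Complex.I * (l : ℂ) * x = Complex.I * x * l by ring]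
        ring
      simp_rw [this]
      rw [integral_const_mul]
      ring
    simp_rw [h1, h2]
    rw [integral_const_mul, integral_const_mul, hswap]

theorem HasFourierTransform.locallyIntegrable {f g : ℝ → ℂ}
    (h : HasFourierTransform f g) : LocallyIntegrable g := by
  intro x
  let b : ContDiffBump x := ⟨1, 2, one_pos, one_lt_two⟩
  have hs : HasCompactSupport (Complex.ofRealCLM ∘ b) := b.hasCompactSupport.comp_left rfl
  have hi := h.integrable_right
    (hs.toSchwartzMap (Complex.ofRealCLM.contDiff.comp b.contDiff))
  refine ⟨Metric.closedBall x 1, Metric.closedBall_mem_nhds x one_pos,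
    hi.integrableOn.congr_fun (fun y hy => ?_) Metric.isClosed_closedBall.measurableSet⟩
  simp [b.one_of_mem_closedBall hy]

theorem HasFourierTransform.ae_eq {f g₁ g₂ : ℝ → ℂ} (h₁ : HasFourierTransform f g₁)
    (h₂ : HasFourierTransform f g₂) : g₁ =ᵐ[volume] g₂ := by
  refine ae_eq_of_integral_contDiff_smul_eq h₁.locallyIntegrable h₂.locallyIntegrable
    fun u hu hc => ?_
  have hs : HasCompactSupport (Complex.ofRealCLM ∘ u) := hc.comp_left rfl
  have := (h₁.integral_eq (hs.toSchwartzMap (Complex.ofRealCLM.contDiff.comp hu))).trans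
    (h₂.integral_eq (hs.toSchwartzMap (Complex.ofRealCLM.contDiff.comp hu))).symm
  simpa [mul_comm] using this

end

end SmoothSums

namespace SmoothSums

/-! Complete multiplicativity turns `phiN` into a quotient of finite Euler products. Since `‖α / p‖
< 1`, every local factor has a principal logarithm, and since `k ≥ 2` that logarithm is its linear
term plus a quadratic error. Hence `phiN = exp (α * primeExpSum + r)`, with `r` both bounded and
`O(|l| / log N)` (`exists_phiN_eq_exp`).

Mertens' first theorem and Abel summation replace `primeExpSum` by `expIntegral`, at the cost `(|l|
/ log N) (1 + log (1 + |l|))`. Moreover `expIntegral l = -log (1 + |l|) + O(1)`, so `|phi|` is at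
most of order `(1 + |l|) ^ (-Re α)`. For `|l| / log N` small, `phiN - phi` is thus at most `(1 +
|l|) ^ (1 - Re α + 2τ) / log N` up to a constant, for any fixed `τ > 0`
(`exists_norm_phiN_sub_phi_le`). For all `l`, `Re (α (e ^ (iθ) - 1)) ≤ ‖α‖ - Re α` and `∑ 1 / p ≤
log log N + O(1)` give `|phiN| ≤ C (log N) ^ (‖α‖ - Re α)` (`exists_norm_phiN_le`).

Integrating the second bound against the decay of the Fourier transform over `|l| > R` produces the
second error term. Over `|l| ≤ R` the first bound gives `O(1 / log N)` when `η` is large; otherwise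
`R ≤ log N` lets the second error term absorb it (`isBigO_integral_phiN_sub_phi_mul`). -/

/-! ### Mertens' first theorem -/

theorem log_factorial_eq_sum_primesLE (n : ℕ) :
    Real.log (n.factorial : ℝ) =
      ∑ p ∈ n.primesLE, (n.factorial.factorization p : ℝ) * Real.log p := by
  have h : n.factorial = ∏ p ∈ n.primesLE, p ^ n.factorial.factorization p := by
    conv_lhs => rw [← Nat.prod_factorization_pow_eq_self n.factorial_ne_zero]
    refine Finsupp.prod_of_support_subset _ (fun p hp => ?_) _ (fun p _ => pow_zero p)
    have hp' := Nat.prime_of_mem_primeFactors hp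
    exact Nat.mem_primesLE.2 ⟨(hp'.dvd_factorial).1 (Nat.dvd_of_mem_primeFactors hp), hp'⟩
  have h' : (n.factorial : ℝ) =
      ∏ p ∈ n.primesLE, (p : ℝ) ^ n.factorial.factorization p := by
    conv_lhs => rw [h]
    push_cast
    rfl
  rw [h', Real.log_prod]
  · exact Finset.sum_congr rfl fun p _ => Real.log_pow _ _
  · intro p hp
    have := (Nat.prime_of_mem_primesLE hp).pos
    positivity

theorem factorization_factorial_le {n p : ℕ} (hp : p.Prime) :
    (n.factorial.factorization p : ℝ) ≤ n / ((p : ℝ) - 1) := by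
  have h1 : (1 : ℝ) < p := by exact_mod_cast hp.one_lt
  rw [le_div_iff₀ (by linarith)]
  have h := Nat.sub_one_mul_factorization_factorial (n := n) hp
  have h2 : (p - 1) * n.factorial.factorization p ≤ n := by omega
  have h3 : (((p - 1) * n.factorial.factorization p : ℕ) : ℝ) ≤ n := by exact_mod_cast h2
  rw [Nat.cast_mul, Nat.cast_sub hp.one_lt.le] at h3
  push_cast at h3
  linarith

theorem le_factorization_factorial {n p : ℕ} (hp : p.Prime) :
    (n : ℝ) / p - 1 ≤ n.factorial.factorization p := by
  have h : n / p ≤ n.factorial.factorization p := by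
    rw [Nat.factorization_factorial hp (b := Nat.log p n + 2) (by omega)]
    have := Finset.single_le_sum (f := fun i => n / p ^ i) (fun i _ => Nat.zero_le _)
      (Finset.mem_Ico.2 ⟨le_rfl, by omega⟩ : 1 ∈ Finset.Ico 1 (Nat.log p n + 2))
    simpa using this
  have h2 : ((n / p : ℕ) : ℝ) ≤ n.factorial.factorization p := by exact_mod_cast h
  have h3 : (n : ℝ) / p < (n / p : ℕ) + 1 := by
    rw [← Nat.floor_div_eq_div (K := ℝ)]
    exact Nat.lt_floor_add_one _
  linarith

/-- Since `log p ≤ 2 √p`, the terms are at most `4 p ^ (-3/2)`. This controls the higher prime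
powers, both in `n!` and in the Euler factors. -/
theorem exists_sum_primesLE_log_div_mul_le :
    ∃ C : ℝ, 0 ≤ C ∧ ∀ n : ℕ,
      ∑ p ∈ n.primesLE, Real.log p / ((p : ℝ) * ((p : ℝ) - 1)) ≤ C := by
  have hs : Summable fun n : ℕ => 4 * (1 / (n : ℝ) ^ (3 / 2 : ℝ)) :=
    (Real.summable_one_div_nat_rpow.2 (by norm_num)).mul_left 4
  refine ⟨∑' n : ℕ, 4 * (1 / (n : ℝ) ^ (3 / 2 : ℝ)), tsum_nonneg fun n => by positivity,
    fun n => ?_⟩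
  refine (Finset.sum_le_sum fun p hp => ?_).trans
    (hs.sum_le_tsum n.primesLE fun i _ => by positivity)
  have h2 : (2 : ℝ) ≤ p := by exact_mod_cast Nat.two_le_of_mem_primesLE hp
  have hp0 : (0 : ℝ) < p := by linarith
  have hlog : Real.log p ≤ 2 * (p : ℝ) ^ (1 / 2 : ℝ) := by
    have := Real.log_le_rpow_div hp0.le (show (0 : ℝ) < 1 / 2 by norm_num)
    linarith
  have hmul : (p : ℝ) ^ (1 / 2 : ℝ) * (p : ℝ) ^ (3 / 2 : ℝ) = (p : ℝ) * p := by
    rw [← Real.rpow_add hp0]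
    norm_num
    ring
  rw [mul_one_div, div_le_div_iff₀ (by nlinarith) (by positivity)]
  calc Real.log p * (p : ℝ) ^ (3 / 2 : ℝ)
      ≤ 2 * (p : ℝ) ^ (1 / 2 : ℝ) * (p : ℝ) ^ (3 / 2 : ℝ) := by gcongr
    _ = 2 * ((p : ℝ) * p) := by rw [mul_assoc, hmul]
    _ ≤ 4 * ((p : ℝ) * ((p : ℝ) - 1)) := by nlinarith

/-- Mertens' argument: compare `log n! = n log n + O(n)` with its prime factorization. The exponent
of `p` lies between `n / p - 1` and `n / (p - 1)`; the loss on the left sums to `θ(n) ≤ n log 4`,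
the excess on the right to `n` times the convergent sum of `log p / (p (p - 1))`. -/
theorem exists_abs_sum_primesLE_log_div_sub_log_le :
    ∃ C : ℝ, 0 ≤ C ∧ ∀ n : ℕ, 1 ≤ n →
      |∑ p ∈ n.primesLE, Real.log p / (p : ℝ) - Real.log n| ≤ C := by
  obtain ⟨C, hC0, hC⟩ := exists_sum_primesLE_log_div_mul_le
  refine ⟨1 + C + Real.log 4, by have := Real.log_nonneg (show (1 : ℝ) ≤ 4 by norm_num); linarith,
    fun n hn => ?_⟩
  have hn0 : (0 : ℝ) < n := by exact_mod_cast hn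
  have hlog4 := Real.log_nonneg (show (1 : ℝ) ≤ 4 by norm_num)
  have hup : Real.log (n.factorial : ℝ) ≤ n * Real.log n := by
    rw [← Real.log_pow]
    exact Real.log_le_log (by exact_mod_cast n.factorial_pos)
      (by exact_mod_cast Nat.factorial_le_pow n)
  have hlow : (n : ℝ) * Real.log n - n ≤ Real.log (n.factorial : ℝ) := by
    have h := Stirling.le_log_factorial_stirling (n := n) (by omega)
    have h1 : 0 ≤ Real.log n := Real.log_nonneg (by exact_mod_cast hn)
    have h2 : 0 ≤ Real.log (2 * Real.pi) :=
      Real.log_nonneg (by have := Real.pi_gt_three; linarith)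
    linarith
  have hsum := log_factorial_eq_sum_primesLE n
  have hA : (n : ℝ) * ∑ p ∈ n.primesLE, Real.log p / (p : ℝ) - Chebyshev.theta n ≤
      Real.log (n.factorial : ℝ) := by
    rw [hsum, Chebyshev.theta_eq_sum_primesLE_log, Finset.mul_sum, ← Finset.sum_sub_distrib]
    refine Finset.sum_le_sum fun p hp => ?_
    have hp' := Nat.prime_of_mem_primesLE hp
    have hl : 0 ≤ Real.log p := Real.log_natCast_nonneg p
    have := mul_le_mul_of_nonneg_right (le_factorization_factorial (n := n) hp') hl
    calc (n : ℝ) * (Real.log p / p) - Real.log p = ((n : ℝ) / p - 1) * Real.log p := by ring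
      _ ≤ _ := this
  have hB : Real.log (n.factorial : ℝ) ≤
      (n : ℝ) * ∑ p ∈ n.primesLE, Real.log p / (p : ℝ) +
        n * ∑ p ∈ n.primesLE, Real.log p / ((p : ℝ) * ((p : ℝ) - 1)) := by
    rw [hsum, ← mul_add, ← Finset.sum_add_distrib, Finset.mul_sum]
    refine Finset.sum_le_sum fun p hp => ?_
    have hp' := Nat.prime_of_mem_primesLE hp
    have h1 : (1 : ℝ) < p := by exact_mod_cast hp'.one_lt
    have hl : 0 ≤ Real.log p := Real.log_natCast_nonneg p
    have := mul_le_mul_of_nonneg_right (factorization_factorial_le (n := n) hp') hl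
    refine this.trans_eq ?_
    have h2 : (p : ℝ) - 1 ≠ 0 := by linarith
    have h3 : (p : ℝ) ≠ 0 := by linarith
    field_simp
    ring
  have hth := Chebyshev.theta_le_log4_mul_x (x := n) hn0.le
  have hCn := mul_le_mul_of_nonneg_left (hC n) hn0.le
  rw [abs_le]
  constructor
  · refine le_of_mul_le_mul_left ?_ hn0
    nlinarith
  · refine le_of_mul_le_mul_left ?_ hn0
    nlinarith

/-- The sequence `log n / n` on the primes, zero elsewhere. -/
noncomputable def primeLogDiv (n : ℕ) : ℝ :=
  if n.Prime then Real.log n / n else 0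

theorem sum_Icc_mul_primeLogDiv (F : ℕ → ℂ) (n : ℕ) :
    ∑ m ∈ Finset.Icc 0 n, F m * (primeLogDiv m : ℂ) =
      ∑ p ∈ n.primesLE, F p * ((Real.log p / p : ℝ) : ℂ) := by
  rw [Nat.primesLE_eq_filter_Icc_zero, Finset.sum_filter]
  refine Finset.sum_congr rfl fun m _ => ?_
  unfold primeLogDiv
  split_ifs <;> simp

theorem exists_norm_sum_primeLogDiv_sub_log_le :
    ∃ C : ℝ, 0 ≤ C ∧ ∀ x : ℝ, 1 ≤ x →
      ‖∑ m ∈ Finset.Icc 0 ⌊x⌋₊, (primeLogDiv m : ℂ) - (Real.log x : ℂ)‖ ≤ C := by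
  obtain ⟨C, hC0, hC⟩ := exists_abs_sum_primesLE_log_div_sub_log_le
  refine ⟨C + Real.log 2, by have := Real.log_nonneg (show (1 : ℝ) ≤ 2 by norm_num); linarith,
    fun x hx => ?_⟩
  have hn : 1 ≤ ⌊x⌋₊ := (Nat.one_le_floor_iff x).2 hx
  have hn' : (1 : ℝ) ≤ ⌊x⌋₊ := by exact_mod_cast hn
  have h1 := sum_Icc_mul_primeLogDiv (fun _ => 1) ⌊x⌋₊
  simp only [one_mul] at h1
  rw [h1, ← Complex.ofReal_sum, ← Complex.ofReal_sub, Complex.norm_real, Real.norm_eq_abs]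
  have h2 := abs_le.1 (hC _ hn)
  have h3 : Real.log ⌊x⌋₊ ≤ Real.log x :=
    Real.log_le_log (by linarith) (Nat.floor_le (by linarith))
  have h4 : Real.log x ≤ Real.log 2 + Real.log ⌊x⌋₊ := by
    rw [← Real.log_mul (by norm_num) (by linarith)]
    refine Real.log_le_log (by linarith) ?_
    have := Nat.lt_floor_add_one x
    linarith
  rw [abs_le]
  constructor <;> linarith

/-! ### Abel summation over the primes -/

theorem integral_comp_log_div {E : Type*} [NormedAddCommGroup E] [NormedSpace ℝ E]
    {a b : ℝ} (ha : 0 < a) (hab : a ≤ b) {g : ℝ → E}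
    (hg : ContinuousOn g (Set.Icc (Real.log a) (Real.log b))) :
    ∫ x in a..b, x⁻¹ • g (Real.log x) = ∫ t in Real.log a..Real.log b, g t := by
  have hpos : ∀ x ∈ Set.uIcc a b, 0 < x := fun x hx =>
    ha.trans_le (Set.uIcc_of_le hab ▸ hx).1
  refine intervalIntegral.integral_deriv_smul_comp' (f := Real.log) (g := g)
    (fun x hx => Real.hasDerivAt_log (hpos x hx).ne')
    (continuousOn_id.inv₀ fun x hx => (hpos x hx).ne') (hg.mono ?_)
  rintro _ ⟨x, hx, rfl⟩
  rw [Set.uIcc_of_le hab] at hx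
  exact ⟨Real.log_le_log ha hx.1, Real.log_le_log (ha.trans_le hx.1) hx.2⟩

/-- Abel summation with `∑ log p / p = log x + O(1)`: the main term `log x`, integrated by parts and
substituted `t = log x`, returns the integral of `h`, and the bounded remainder is paid for by the
boundary values and the variation of `h`. The majorant `B` allows an explicitly integrable bound in
place of `‖h'‖`. -/
theorem exists_norm_sum_primesLE_sub_integral_le :
    ∃ C : ℝ, 0 ≤ C ∧ ∀ (N : ℕ), 2 ≤ N → ∀ (h h' : ℝ → ℂ) (B : ℝ → ℝ),
      (∀ t, 0 < t → HasDerivAt h (h' t) t) → ContinuousOn h' (Set.Ioi 0) →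
      ContinuousOn B (Set.Icc (Real.log 2) (Real.log N)) →
      (∀ t ∈ Set.Icc (Real.log 2) (Real.log N), ‖h' t‖ ≤ B t) →
      ‖∑ p ∈ N.primesLE, h (Real.log p) * ((Real.log p / p : ℝ) : ℂ) -
        ∫ t in Real.log 2..Real.log N, h t‖ ≤
        C * (‖h (Real.log N)‖ + ‖h (Real.log 2)‖ + ∫ t in Real.log 2..Real.log N, B t) := by
  obtain ⟨C, hC0, hC⟩ := exists_norm_sum_primeLogDiv_sub_log_le
  -- The extra `log 2` pays for the boundary term at `x = 2` in the integration by parts.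
  refine ⟨C + Real.log 2, by have := Real.log_nonneg (show (1 : ℝ) ≤ 2 by norm_num); linarith,
    fun N hN h h' B hder hcont hB hbd => ?_⟩
  have hN' : (2 : ℝ) ≤ N := by exact_mod_cast hN
  have hlog2 : 0 < Real.log 2 := Real.log_pos one_lt_two
  have hlogle : Real.log 2 ≤ Real.log N := Real.log_le_log two_pos hN'
  have hlogpos : ∀ x ∈ Set.Icc (2 : ℝ) N, 0 < Real.log x := fun x hx =>
    Real.log_pos (by linarith [hx.1])
  set M : ℝ → ℂ := fun x => ∑ m ∈ Finset.Icc 0 ⌊x⌋₊, (primeLogDiv m : ℂ) with hM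
  set F : ℝ → ℂ := fun x => h (Real.log x) with hF
  set F' : ℝ → ℂ := fun x => x⁻¹ • h' (Real.log x) with hF'
  have hFder : ∀ x ∈ Set.Icc (2 : ℝ) N, HasDerivAt F (F' x) x := fun x hx =>
    (hder _ (hlogpos x hx)).scomp x (Real.hasDerivAt_log (by linarith [hx.1]))
  have hlogcont : ContinuousOn Real.log (Set.Icc (2 : ℝ) N) :=
    Real.continuousOn_log.mono fun x hx => by
      simp only [Set.mem_compl_iff, Set.mem_singleton_iff]
      linarith [hx.1]
  have hinvcont : ContinuousOn (fun x : ℝ => x⁻¹) (Set.Icc (2 : ℝ) N) :=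
    continuousOn_id.inv₀ fun x hx => by simp only [id]; linarith [hx.1]
  have hF'cont : ContinuousOn F' (Set.Icc (2 : ℝ) N) :=
    hinvcont.smul (hcont.comp hlogcont hlogpos)
  have hFcont : ContinuousOn F (Set.Icc (2 : ℝ) N) := fun x hx =>
    (hFder x hx).continuousAt.continuousWithinAt
  have hderivF : ∀ x ∈ Set.Icc (2 : ℝ) N, deriv F x = F' x := fun x hx => (hFder x hx).deriv
  have hF'int : IntegrableOn F' (Set.Icc (2 : ℝ) N) := hF'cont.integrableOn_Icc
  have habel := sum_mul_eq_sub_integral_mul₁ (fun m => (primeLogDiv m : ℂ)) (f := F)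
    (by simp [primeLogDiv]) (by simp [primeLogDiv, Nat.not_prime_one]) (N : ℝ)
    (fun x hx => (hFder x hx).differentiableAt)
    (hF'int.congr_fun (fun x hx => (hderivF x hx).symm) measurableSet_Icc)
  rw [Nat.floor_natCast, sum_Icc_mul_primeLogDiv (fun m => F m)] at habel
  have hint1 : ∫ t in Set.Ioc (2 : ℝ) N, deriv F t * ∑ k ∈ Finset.Icc 0 ⌊t⌋₊, (primeLogDiv k : ℂ) =
      ∫ t in (2 : ℝ)..N, F' t * M t := by
    rw [intervalIntegral.integral_of_le hN']
    exact setIntegral_congr_fun measurableSet_Ioc fun x hx => by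
      simp only [hderivF x ⟨hx.1.le, hx.2⟩, hM]
  have hFM : IntervalIntegrable (fun t => F' t * M t) volume 2 N := by
    rw [intervalIntegrable_iff_integrableOn_Icc_of_le hN']
    exact integrableOn_mul_sum_Icc _ zero_le_two hF'int
  have hlogC : ContinuousOn (fun x : ℝ => (Real.log x : ℂ)) (Set.Icc (2 : ℝ) N) :=
    Complex.continuous_ofReal.comp_continuousOn hlogcont
  have hFL : IntervalIntegrable (fun t => F' t * (Real.log t : ℂ)) volume 2 N := by
    refine ContinuousOn.intervalIntegrable ?_
    rw [Set.uIcc_of_le hN']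
    exact hF'cont.mul hlogC
  have hparts : ∫ t in (2 : ℝ)..N, F' t * (Real.log t : ℂ) =
      F N * (Real.log N : ℂ) - F 2 * (Real.log 2 : ℂ) -
        ∫ t in Real.log 2..Real.log N, h t := by
    have hsub := integral_comp_log_div two_pos hN' (g := h) fun t ht =>
      (hder t (hlog2.trans_le ht.1)).continuousAt.continuousWithinAt
    have := intervalIntegral.integral_mul_deriv_eq_deriv_mul (a := (2 : ℝ)) (b := N)
      (u := fun x : ℝ => (Real.log x : ℂ)) (u' := fun x : ℝ => ((x⁻¹ : ℝ) : ℂ)) (v := F) (v' := F')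
      (fun x hx => by
        rw [Set.uIcc_of_le hN'] at hx
        exact (Real.hasDerivAt_log (by linarith [hx.1])).ofReal_comp)
      (fun x hx => by
        rw [Set.uIcc_of_le hN'] at hx
        exact hFder x hx)
      (by
        refine ContinuousOn.intervalIntegrable ?_
        rw [Set.uIcc_of_le hN']
        exact Complex.continuous_ofReal.comp_continuousOn hinvcont)
      (by
        refine ContinuousOn.intervalIntegrable ?_
        rwa [Set.uIcc_of_le hN'])
    rw [← hsub]
    simp only [mul_comm (F' _), this, Complex.real_smul, hF]
    ring
  have hE : IntervalIntegrable (fun t => F' t * (M t - (Real.log t : ℂ))) volume 2 N := by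
    simpa only [mul_sub] using hFM.sub hFL
  have hEeq : ∫ t in (2 : ℝ)..N, F' t * (M t - (Real.log t : ℂ)) =
      (∫ t in (2 : ℝ)..N, F' t * M t) - ∫ t in (2 : ℝ)..N, F' t * (Real.log t : ℂ) := by
    simp only [mul_sub]
    exact intervalIntegral.integral_sub hFM hFL
  have hBnorm : ‖∫ t in (2 : ℝ)..N, F' t * (M t - (Real.log t : ℂ))‖ ≤
      C * ∫ t in Real.log 2..Real.log N, B t := by
    rw [← integral_comp_log_div two_pos hN' hB, ← intervalIntegral.integral_const_mul]
    refine intervalIntegral.norm_integral_le_of_norm_le hN' (ae_of_all _ fun x hx => ?_) ?_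
    · have hx' : x ∈ Set.Icc (2 : ℝ) N := ⟨hx.1.le, hx.2⟩
      have hx0 : 0 < x := by linarith [hx.1]
      have h1 := hC x (by linarith [hx.1])
      have h2 := hbd (Real.log x) ⟨Real.log_le_log two_pos hx'.1, Real.log_le_log hx0 hx'.2⟩
      rw [norm_mul, norm_smul, Real.norm_of_nonneg (inv_nonneg.2 hx0.le), mul_comm, smul_eq_mul]
      gcongr
    · refine ContinuousOn.intervalIntegrable ?_
      rw [Set.uIcc_of_le hN']
      refine continuousOn_const.mul (hinvcont.smul (hB.comp hlogcont fun x hx => ?_))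
      exact ⟨Real.log_le_log two_pos hx.1, Real.log_le_log (by linarith [hx.1]) hx.2⟩
  have hkey : ∑ p ∈ N.primesLE, h (Real.log p) * ((Real.log p / p : ℝ) : ℂ) -
        ∫ t in Real.log 2..Real.log N, h t =
      h (Real.log N) * (M N - (Real.log N : ℂ)) + h (Real.log 2) * (Real.log 2 : ℂ) -
        ∫ t in (2 : ℝ)..N, F' t * (M t - (Real.log t : ℂ)) := by
    have hMN : M N = ∑ k ∈ Finset.Icc 0 N, (primeLogDiv k : ℂ) := by simp [hM]
    rw [habel, hint1, hEeq, hparts, hMN]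
    simp only [hF]
    ring
  have hB0 : 0 ≤ ∫ t in Real.log 2..Real.log N, B t :=
    intervalIntegral.integral_nonneg hlogle fun t ht => (norm_nonneg _).trans (hbd t ht)
  have hN1 := hC N (by linarith)
  rw [hkey]
  calc _ ≤ ‖h (Real.log N) * (M N - (Real.log N : ℂ))‖ + ‖h (Real.log 2) * (Real.log 2 : ℂ)‖ +
        ‖∫ t in (2 : ℝ)..N, F' t * (M t - (Real.log t : ℂ))‖ :=
        (norm_sub_le _ _).trans (add_le_add_left (norm_add_le _ _) _)
    _ ≤ ‖h (Real.log N)‖ * C + ‖h (Real.log 2)‖ * Real.log 2 +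
        C * ∫ t in Real.log 2..Real.log N, B t := by
        rw [norm_mul, norm_mul, Complex.norm_real, Real.norm_of_nonneg hlog2.le]
        gcongr
    _ ≤ _ := by
        have := norm_nonneg (h (Real.log N))
        have := norm_nonneg (h (Real.log 2))
        nlinarith [mul_nonneg hlog2.le hB0, mul_nonneg hlog2.le (norm_nonneg (h (Real.log N))),
          mul_nonneg hC0 (norm_nonneg (h (Real.log 2)))]

/-- The upper half of Mertens' second theorem: Abel summation with `h t = 1 / t`. -/
theorem exists_sum_primesLE_inv_le :
    ∃ C : ℝ, ∀ N : ℕ, 2 ≤ N →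
      ∑ p ∈ N.primesLE, (p : ℝ)⁻¹ ≤ Real.log (Real.log N) + C := by
  obtain ⟨C, hC0, hC⟩ := exists_norm_sum_primesLE_sub_integral_le
  have hlog2 : 0 < Real.log 2 := Real.log_pos one_lt_two
  refine ⟨-Real.log (Real.log 2) + C * (2 * (Real.log 2)⁻¹), fun N hN => ?_⟩
  have hN' : (2 : ℝ) ≤ N := by exact_mod_cast hN
  have hlogle : Real.log 2 ≤ Real.log N := Real.log_le_log two_pos hN'
  have hL : 0 < Real.log N := hlog2.trans_le hlogle
  have hne : (0 : ℝ) ∉ Set.uIcc (Real.log 2) (Real.log N) := by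
    rw [Set.uIcc_of_le hlogle]
    exact fun h => absurd h.1 (not_le.2 hlog2)
  have hcont2 : ContinuousOn (fun t : ℝ => (t ^ 2)⁻¹) (Set.Ioi 0) :=
    (continuousOn_pow 2).inv₀ fun t ht => pow_ne_zero 2 (ne_of_gt ht)
  have key := hC N hN (fun t => ((t⁻¹ : ℝ) : ℂ)) (fun t => ((-(t ^ 2)⁻¹ : ℝ) : ℂ))
    (fun t => (t ^ 2)⁻¹) (fun t ht => (hasDerivAt_inv ht.ne').ofReal_comp)
    (Complex.continuous_ofReal.comp_continuousOn hcont2.neg)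
    (hcont2.mono fun t ht => hlog2.trans_le ht.1)
    (fun t _ => by
      rw [Complex.norm_real, norm_neg, Real.norm_of_nonneg (by positivity)])
  have hsum : ∑ p ∈ N.primesLE, (((Real.log p)⁻¹ : ℝ) : ℂ) * ((Real.log p / p : ℝ) : ℂ) =
      ((∑ p ∈ N.primesLE, (p : ℝ)⁻¹ : ℝ) : ℂ) := by
    rw [Complex.ofReal_sum]
    refine Finset.sum_congr rfl fun p hp => ?_
    have h1 : (1 : ℝ) < p := by exact_mod_cast Nat.one_lt_of_mem_primesLE hp
    have h2 : Real.log p ≠ 0 := (Real.log_pos h1).ne'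
    rw [← Complex.ofReal_mul]
    congr 1
    field_simp
  have hB : ∫ t in Real.log 2..Real.log N, (t ^ 2)⁻¹ = (Real.log 2)⁻¹ - (Real.log N)⁻¹ := by
    have := intervalIntegral.integral_eq_sub_of_hasDerivAt (a := Real.log 2) (b := Real.log N)
      (f := fun t : ℝ => -t⁻¹) (f' := fun t : ℝ => (t ^ 2)⁻¹)
      (fun t ht => by
        have ht0 : t ≠ 0 := fun h => hne (h ▸ ht)
        exact (hasDerivAt_inv ht0).neg.congr_deriv (neg_neg _))
      (by
        refine ContinuousOn.intervalIntegrable (hcont2.mono fun t ht => ?_)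
        rw [Set.uIcc_of_le hlogle] at ht
        exact hlog2.trans_le ht.1)
    rw [this]
    ring
  rw [hsum, intervalIntegral.integral_ofReal, integral_inv hne, ← Complex.ofReal_sub,
    Complex.norm_real, Complex.norm_real, Complex.norm_real, hB,
    Real.norm_of_nonneg (inv_nonneg.2 hL.le), Real.norm_of_nonneg (inv_nonneg.2 hlog2.le),
    Real.log_div hL.ne' hlog2.ne', Real.norm_eq_abs] at key
  have := (abs_le.1 key).2
  have h3 : (Real.log N)⁻¹ + (Real.log 2)⁻¹ + ((Real.log 2)⁻¹ - (Real.log N)⁻¹) =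
    2 * (Real.log 2)⁻¹ := by ring
  rw [h3] at this
  linarith

/-! ### The prime exponential sum and the exponent of the limit -/

theorem norm_exp_I_mul_mul (l v : ℝ) : ‖Complex.exp (Complex.I * l * v)‖ = 1 := by
  rw [mul_assoc, ← Complex.ofReal_mul, mul_comm, Complex.norm_exp_ofReal_mul_I]

theorem norm_exp_I_mul_mul_sub_one_le (l v : ℝ) :
    ‖Complex.exp (Complex.I * l * v) - 1‖ ≤ |l| * |v| := by
  rw [mul_assoc, ← Complex.ofReal_mul, ← abs_mul]
  exact Real.norm_exp_I_mul_ofReal_sub_one_le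

theorem norm_exp_I_mul_mul_sub_one_div_le (l v : ℝ) :
    ‖(Complex.exp (Complex.I * l * v) - 1) / v‖ ≤ |l| := by
  rcases eq_or_ne v 0 with rfl | hv
  · simp
  · rw [norm_div, Complex.norm_real, Real.norm_eq_abs, div_le_iff₀ (abs_pos.2 hv)]
    exact norm_exp_I_mul_mul_sub_one_le l v

theorem hasDerivAt_exp_I_mul_mul_sub_one_div (m : ℝ) {t : ℝ} (ht : 0 < t) :
    HasDerivAt (fun t : ℝ => (Complex.exp (Complex.I * m * t) - 1) / (t : ℂ))
      ((Complex.I * m * t * Complex.exp (Complex.I * m * t) -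
        (Complex.exp (Complex.I * m * t) - 1)) / (t : ℂ) ^ 2) t := by
  have ht' : (t : ℂ) ≠ 0 := Complex.ofReal_ne_zero.2 ht.ne'
  have h1 : HasDerivAt (fun z : ℂ => Complex.exp (Complex.I * m * z) - 1)
      (Complex.exp (Complex.I * m * t) * (Complex.I * m)) (t : ℂ) := by
    have := ((hasDerivAt_id (t : ℂ)).const_mul (Complex.I * m)).cexp.sub_const 1
    simpa using this
  have h2 := (h1.div (hasDerivAt_id (t : ℂ)) ht').comp_ofReal
  refine h2.congr_deriv ?_
  simp only [id]
  ring

/-- With `u = |m| t`, the numerator is `O(u ^ 2)` for `u ≤ 1` by cancellation and `O(u)` for `u ≥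
1`. Joining both regimes in one fraction gives a majorant whose primitive is `4 |m| log (1 + |m|
t)`. -/
theorem norm_deriv_exp_I_mul_mul_sub_one_div_le (m : ℝ) {t : ℝ} (ht : 0 < t) :
    ‖(Complex.I * m * t * Complex.exp (Complex.I * m * t) -
        (Complex.exp (Complex.I * m * t) - 1)) / (t : ℂ) ^ 2‖ ≤
      4 * m ^ 2 / (1 + |m| * t) := by
  set z : ℂ := Complex.I * m * t with hz
  have hzn : ‖z‖ = |m| * t := by
    simp [hz, abs_of_pos ht]
  have hE : ‖Complex.exp z‖ = 1 := norm_exp_I_mul_mul m t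
  have hE1 : ‖Complex.exp z - 1‖ ≤ |m| * t := by
    have := norm_exp_I_mul_mul_sub_one_le m t
    rwa [abs_of_pos ht] at this
  set u : ℝ := |m| * t with hu
  have hu0 : 0 ≤ u := by positivity
  have hnum : ‖z * Complex.exp z - (Complex.exp z - 1)‖ ≤ 4 * u ^ 2 / (1 + u) := by
    rw [le_div_iff₀ (by positivity)]
    rcases le_total u 1 with h | h
    · have h1 : ‖Complex.exp z - 1 - z‖ ≤ u ^ 2 := by
        rw [← hzn]
        exact Complex.norm_exp_sub_one_sub_id_le (by rwa [hzn])
      have h2 : ‖z * Complex.exp z - (Complex.exp z - 1)‖ ≤ 2 * u ^ 2 := by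
        calc _ = ‖z * (Complex.exp z - 1) - (Complex.exp z - 1 - z)‖ := by congr 1; ring
          _ ≤ ‖z * (Complex.exp z - 1)‖ + ‖Complex.exp z - 1 - z‖ := norm_sub_le _ _
          _ ≤ u * u + u ^ 2 := by
              rw [norm_mul, hzn]
              gcongr
          _ = _ := by ring
      nlinarith [norm_nonneg (z * Complex.exp z - (Complex.exp z - 1))]
    · have h2 : ‖z * Complex.exp z - (Complex.exp z - 1)‖ ≤ 2 * u := by
        refine (norm_sub_le _ _).trans ?_
        rw [norm_mul, hzn, hE]
        linarith
      nlinarith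
  rw [norm_div, norm_pow, Complex.norm_real, Real.norm_of_nonneg ht.le,
    div_le_iff₀ (by positivity)]
  refine hnum.trans_eq ?_
  rw [hu, mul_pow, sq_abs]
  ring

theorem intervalIntegrable_exp_I_mul_mul_sub_one_div (l a b : ℝ) :
    IntervalIntegrable (fun v : ℝ => (Complex.exp (Complex.I * l * v) - 1) / (v : ℂ))
      volume a b := by
  rw [intervalIntegrable_iff]
  refine Measure.integrableOn_of_bounded (M := |l|) (by simp) ?_
    (ae_of_all _ fun v => norm_exp_I_mul_mul_sub_one_div_le l v)
  exact (by fun_prop : Measurable fun v : ℝ =>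
    (Complex.exp (Complex.I * l * v) - 1) / (v : ℂ)).aestronglyMeasurable

/-- The integral in the exponent of `phi`. -/
noncomputable def expIntegral (l : ℝ) : ℂ :=
  ∫ v in (0 : ℝ)..1, (Complex.exp (Complex.I * l * v) - 1) / v

/-- The sum over the primes approximating `expIntegral`. -/
noncomputable def primeExpSum (N : ℕ) (l : ℝ) : ℂ :=
  ∑ p ∈ N.primesLE, (Complex.exp (Complex.I * l * xi N p) - 1) / (p : ℂ)

/-- Abel summation for `h t = (e ^ (i m t) - 1) / t` with `m = l / log N`. Rescaling `t = v log N`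
turns the integral into `expIntegral` without the piece from `0` to `log 2 / log N`, which is at
most `|m|`. -/
theorem exists_norm_primeExpSum_sub_expIntegral_le :
    ∃ C : ℝ, 0 ≤ C ∧ ∀ N : ℕ, 2 ≤ N → ∀ l : ℝ,
      ‖primeExpSum N l - expIntegral l‖ ≤
        C * (|l| / Real.log N * (1 + Real.log (1 + |l|))) := by
  obtain ⟨C, hC0, hC⟩ := exists_norm_sum_primesLE_sub_integral_le
  have hlog2 : 0 < Real.log 2 := Real.log_pos one_lt_two
  refine ⟨4 * C + 1, by linarith, fun N hN l => ?_⟩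
  have hN' : (2 : ℝ) ≤ N := by exact_mod_cast hN
  have hlogle : Real.log 2 ≤ Real.log N := Real.log_le_log two_pos hN'
  set L : ℝ := Real.log N with hLdef
  have hL : 0 < L := hlog2.trans_le hlogle
  set m : ℝ := l / L with hm
  have hmabs : |m| = |l| / L := by rw [hm, abs_div, abs_of_pos hL]
  have hmL : m * L = l := div_mul_cancel₀ l hL.ne'
  have hden : ∀ t ∈ Set.Icc (Real.log 2) L, 0 < 1 + |m| * t := fun t ht => by
    have : 0 < t := hlog2.trans_le ht.1
    positivity
  have hBcont : ContinuousOn (fun t : ℝ => 4 * m ^ 2 / (1 + |m| * t))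
      (Set.Icc (Real.log 2) L) :=
    continuousOn_const.div (by fun_prop) fun t ht => (hden t ht).ne'
  have key := hC N hN (fun t => (Complex.exp (Complex.I * m * t) - 1) / (t : ℂ)) _
    (fun t => 4 * m ^ 2 / (1 + |m| * t))
    (fun t ht => hasDerivAt_exp_I_mul_mul_sub_one_div m ht)
    (ContinuousOn.div (by fun_prop) (by fun_prop) fun t ht =>
      pow_ne_zero 2 (Complex.ofReal_ne_zero.2 (ne_of_gt ht)))
    hBcont
    (fun t ht => norm_deriv_exp_I_mul_mul_sub_one_div_le m (hlog2.trans_le ht.1))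
  have hB : ∫ t in Real.log 2..L, 4 * m ^ 2 / (1 + |m| * t) ≤
      4 * |m| * Real.log (1 + |l|) := by
    have := intervalIntegral.integral_eq_sub_of_hasDerivAt (a := Real.log 2) (b := L)
      (f := fun t : ℝ => 4 * |m| * Real.log (1 + |m| * t))
      (f' := fun t : ℝ => 4 * m ^ 2 / (1 + |m| * t))
      (fun t ht => by
        rw [Set.uIcc_of_le hlogle] at ht
        have h1 : HasDerivAt (fun t : ℝ => 1 + |m| * t) |m| t := by
          simpa using ((hasDerivAt_id t).const_mul |m|).const_add 1
        refine ((h1.log (hden t ht).ne').const_mul (4 * |m|)).congr_deriv ?_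
        rw [← sq_abs m]
        ring)
      (by
        refine ContinuousOn.intervalIntegrable ?_
        rwa [Set.uIcc_of_le hlogle])
    rw [this]
    have h1 : |m| * L = |l| := by rw [hmabs, div_mul_cancel₀ _ hL.ne']
    have h2 : 0 ≤ Real.log (1 + |m| * Real.log 2) :=
      Real.log_nonneg (by have := mul_nonneg (abs_nonneg m) hlog2.le; linarith)
    rw [h1]
    have := mul_nonneg (mul_nonneg zero_le_four (abs_nonneg m)) h2
    linarith
  have hsum : ∑ p ∈ N.primesLE,
      (Complex.exp (Complex.I * m * (Real.log p : ℝ)) - 1) / ((Real.log p : ℝ) : ℂ) *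
        ((Real.log p / p : ℝ) : ℂ) = primeExpSum N l := by
    refine Finset.sum_congr rfl fun p hp => ?_
    have h1 : (1 : ℝ) < p := by exact_mod_cast Nat.one_lt_of_mem_primesLE hp
    have h2 : ((Real.log p : ℝ) : ℂ) ≠ 0 := Complex.ofReal_ne_zero.2 (Real.log_pos h1).ne'
    have h3 : (p : ℂ) ≠ 0 := by
      exact_mod_cast (Nat.prime_of_mem_primesLE hp).ne_zero
    have h4 : Complex.I * m * (Real.log p : ℝ) = Complex.I * l * xi N p := by
      simp only [xi, hm, ← hLdef]
      push_cast
      ring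
    rw [h4, Complex.ofReal_div, Complex.ofReal_natCast]
    field_simp
  have hint : ∫ t in Real.log 2..L, (Complex.exp (Complex.I * m * t) - 1) / (t : ℂ) =
      expIntegral l -
        ∫ v in (0 : ℝ)..Real.log 2 / L, (Complex.exp (Complex.I * l * v) - 1) / (v : ℂ) := by
    rw [expIntegral, intervalIntegral.integral_interval_sub_left
      (intervalIntegrable_exp_I_mul_mul_sub_one_div l _ _)
      (intervalIntegrable_exp_I_mul_mul_sub_one_div l _ _)]
    have := intervalIntegral.smul_integral_comp_mul_left (a := Real.log 2 / L) (b := 1)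
      (fun t : ℝ => (Complex.exp (Complex.I * m * t) - 1) / (t : ℂ)) L
    rw [mul_one, mul_div_cancel₀ _ hL.ne'] at this
    rw [← this, ← intervalIntegral.integral_smul]
    refine intervalIntegral.integral_congr fun v _ => ?_
    have hLc : (L : ℂ) ≠ 0 := Complex.ofReal_ne_zero.2 hL.ne'
    have h4 : Complex.I * m * ((L * v : ℝ) : ℂ) = Complex.I * l * v := by
      rw [← hmL]
      push_cast
      ring
    simp only [h4, Complex.real_smul]
    push_cast
    rw [← mul_div_assoc, mul_div_mul_left _ _ hLc]
  have hsmall : ‖∫ v in (0 : ℝ)..Real.log 2 / L,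
      (Complex.exp (Complex.I * l * v) - 1) / (v : ℂ)‖ ≤ |m| := by
    have := intervalIntegral.norm_integral_le_of_norm_le_const (a := (0 : ℝ))
      (b := Real.log 2 / L) (C := |l|)
      (f := fun v : ℝ => (Complex.exp (Complex.I * l * v) - 1) / (v : ℂ))
      fun v _ => norm_exp_I_mul_mul_sub_one_div_le l v
    refine this.trans ?_
    have h0 : Real.log 2 ≤ 1 := by have := Real.log_two_lt_d9; linarith
    rw [sub_zero, abs_of_nonneg (div_nonneg hlog2.le hL.le), hmabs, mul_div_assoc']
    gcongr
    exact mul_le_of_le_one_right (abs_nonneg l) h0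
  rw [hsum, hint] at key
  have h1 := norm_exp_I_mul_mul_sub_one_div_le m L
  have h2 := norm_exp_I_mul_mul_sub_one_div_le m (Real.log 2)
  have hlog0 : 0 ≤ Real.log (1 + |l|) := Real.log_nonneg (by have := abs_nonneg l; linarith)
  rw [← hmabs]
  have h3 : ‖primeExpSum N l - expIntegral l‖ ≤
      C * (|m| + |m| + 4 * |m| * Real.log (1 + |l|)) + |m| := by
    calc _ = ‖(primeExpSum N l - (expIntegral l -
          ∫ v in (0 : ℝ)..Real.log 2 / L, (Complex.exp (Complex.I * l * v) - 1) / (v : ℂ))) -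
          ∫ v in (0 : ℝ)..Real.log 2 / L, (Complex.exp (Complex.I * l * v) - 1) / (v : ℂ)‖ := by
          congr 1; ring
      _ ≤ _ := (norm_sub_le _ _).trans (add_le_add (key.trans (by gcongr)) hsmall)
  refine h3.trans ?_
  nlinarith [mul_nonneg hC0 (abs_nonneg m), mul_nonneg (abs_nonneg m) hlog0]

/-- Integration by parts exploits the oscillation: the two boundary terms are `|l|⁻¹` and `1` in
size, and the remaining integral is at most `1`. -/
theorem norm_integral_inv_mul_exp_le {l : ℝ} (hl : 1 ≤ |l|) :
    ‖∫ v in |l|⁻¹..1, ((v⁻¹ : ℝ) : ℂ) * Complex.exp (Complex.I * l * v)‖ ≤ 3 := by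
  have hl0 : 0 < |l| := by linarith
  have ha0 : 0 < |l|⁻¹ := inv_pos.2 hl0
  have ha1 : |l|⁻¹ ≤ 1 := inv_le_one_of_one_le₀ hl
  have hlc : Complex.I * (l : ℂ) ≠ 0 :=
    mul_ne_zero Complex.I_ne_zero (Complex.ofReal_ne_zero.2 (abs_pos.1 hl0))
  have hnorm : ‖Complex.I * (l : ℂ)‖ = |l| := by simp
  have hpos : ∀ v ∈ Set.uIcc |l|⁻¹ 1, 0 < v := fun v hv => by
    rw [Set.uIcc_of_le ha1] at hv
    exact ha0.trans_le hv.1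
  have hcont2 : ContinuousOn (fun t : ℝ => (t ^ 2)⁻¹) (Set.uIcc |l|⁻¹ 1) :=
    (continuousOn_pow 2).inv₀ fun t ht => pow_ne_zero 2 (hpos t ht).ne'
  have hE : ∀ v : ℝ, ‖Complex.exp (Complex.I * l * v) / (Complex.I * l)‖ = |l|⁻¹ := fun v => by
    rw [norm_div, hnorm, norm_exp_I_mul_mul, one_div]
  have hparts := intervalIntegral.integral_mul_deriv_eq_deriv_mul (a := |l|⁻¹) (b := 1)
    (u := fun v : ℝ => ((v⁻¹ : ℝ) : ℂ)) (u' := fun v : ℝ => ((-(v ^ 2)⁻¹ : ℝ) : ℂ))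
    (v := fun v : ℝ => Complex.exp (Complex.I * l * v) / (Complex.I * l))
    (v' := fun v : ℝ => Complex.exp (Complex.I * l * v))
    (fun v hv => (hasDerivAt_inv (hpos v hv).ne').ofReal_comp)
    (fun v _ => by
      have h1 : HasDerivAt (fun z : ℂ => Complex.exp (Complex.I * l * z) / (Complex.I * l))
          (Complex.exp (Complex.I * l * v) * (Complex.I * l) / (Complex.I * l)) (v : ℂ) := by
        have := ((hasDerivAt_id (v : ℂ)).const_mul (Complex.I * l)).cexp.div_const (Complex.I * l)
        simpa using this
      rw [mul_div_cancel_right₀ _ hlc] at h1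
      exact h1.comp_ofReal)
    (Complex.continuous_ofReal.comp_continuousOn hcont2.neg).intervalIntegrable
    (by fun_prop : Continuous fun v : ℝ =>
      Complex.exp (Complex.I * l * v)).continuousOn.intervalIntegrable
  have hI : ‖∫ v in |l|⁻¹..1, ((-(v ^ 2)⁻¹ : ℝ) : ℂ) *
      (Complex.exp (Complex.I * l * v) / (Complex.I * l))‖ ≤ 1 := by
    have hle : ‖∫ v in |l|⁻¹..1, ((-(v ^ 2)⁻¹ : ℝ) : ℂ) *
      (Complex.exp (Complex.I * l * v) / (Complex.I * l))‖ ≤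
        ∫ v in |l|⁻¹..1, (v ^ 2)⁻¹ * |l|⁻¹ := by
      refine intervalIntegral.norm_integral_le_of_norm_le ha1 (ae_of_all _ fun v _ => ?_) ?_
      · rw [norm_mul, hE, Complex.norm_real, norm_neg, Real.norm_of_nonneg (by positivity)]
      · exact (hcont2.mul continuousOn_const).intervalIntegrable
    refine hle.trans ?_
    have := intervalIntegral.integral_eq_sub_of_hasDerivAt (a := |l|⁻¹) (b := 1)
      (f := fun t : ℝ => -t⁻¹) (f' := fun t : ℝ => (t ^ 2)⁻¹)
      (fun t ht => (hasDerivAt_inv (hpos t ht).ne').neg.congr_deriv (neg_neg _))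
      hcont2.intervalIntegrable
    rw [intervalIntegral.integral_mul_const, this]
    simp only [inv_one, inv_inv]
    have h3 : |l| * |l|⁻¹ = 1 := mul_inv_cancel₀ hl0.ne'
    nlinarith
  rw [hparts]
  refine (norm_sub_le _ _).trans ?_
  have h1 := norm_sub_le
    (((1 : ℝ)⁻¹ : ℝ) * (Complex.exp (Complex.I * l * (1 : ℝ)) / (Complex.I * l)))
    (((|l|⁻¹⁻¹ : ℝ) : ℂ) * (Complex.exp (Complex.I * l * (|l|⁻¹ : ℝ)) / (Complex.I * l)))
  rw [norm_mul, norm_mul, hE, hE, Complex.norm_real, Complex.norm_real, inv_one, norm_one,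
    inv_inv, Real.norm_of_nonneg hl0.le, mul_inv_cancel₀ hl0.ne', one_mul] at h1
  simp only [inv_one, inv_inv] at h1 ⊢
  linarith

/-- For `|l| ≥ 1`, split at `v = |l|⁻¹`: below, the integrand is at most `|l|`; above, the
oscillating part is bounded and `-1 / v` integrates to `-log |l|`. -/
theorem norm_expIntegral_add_log_le (l : ℝ) :
    ‖expIntegral l + (Real.log (1 + |l|) : ℂ)‖ ≤ 5 := by
  have hlog2 : Real.log 2 ≤ 1 := by have := Real.log_two_lt_d9; linarith
  have habs := abs_nonneg l
  rcases le_total |l| 1 with h | h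
  · have h1 : ‖expIntegral l‖ ≤ |l| := by
      have := intervalIntegral.norm_integral_le_of_norm_le_const (a := (0 : ℝ))
        (b := 1) (C := |l|)
        (f := fun v : ℝ => (Complex.exp (Complex.I * l * v) - 1) / (v : ℂ))
        fun v _ => norm_exp_I_mul_mul_sub_one_div_le l v
      simpa [expIntegral] using this
    have h2 : 0 ≤ Real.log (1 + |l|) := Real.log_nonneg (by linarith)
    have h3 : Real.log (1 + |l|) ≤ Real.log 2 := Real.log_le_log (by linarith) (by linarith)
    refine (norm_add_le _ _).trans ?_
    rw [Complex.norm_real, Real.norm_of_nonneg h2]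
    linarith
  · have hl0 : 0 < |l| := by linarith
    have ha0 : 0 < |l|⁻¹ := inv_pos.2 hl0
    have ha1 : |l|⁻¹ ≤ 1 := inv_le_one_of_one_le₀ h
    have hcont : ContinuousOn (fun v : ℝ => v⁻¹) (Set.uIcc |l|⁻¹ 1) := by
      refine continuousOn_id.inv₀ fun v hv => ?_
      rw [Set.uIcc_of_le ha1] at hv
      exact (ha0.trans_le hv.1).ne'
    have hcontc : ContinuousOn (fun v : ℝ => ((v⁻¹ : ℝ) : ℂ)) (Set.uIcc |l|⁻¹ 1) :=
      Complex.continuous_ofReal.comp_continuousOn hcont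
    have hsplit : expIntegral l =
        (∫ v in (0 : ℝ)..|l|⁻¹, (Complex.exp (Complex.I * l * v) - 1) / (v : ℂ)) +
          ((∫ v in |l|⁻¹..1, ((v⁻¹ : ℝ) : ℂ) * Complex.exp (Complex.I * l * v)) -
            (Real.log |l| : ℂ)) := by
      have h1 : ∫ v in |l|⁻¹..1, (Complex.exp (Complex.I * l * v) - 1) / (v : ℂ) =
          (∫ v in |l|⁻¹..1, ((v⁻¹ : ℝ) : ℂ) * Complex.exp (Complex.I * l * v)) -
            (Real.log |l| : ℂ) := by
        have h2 : (Real.log |l| : ℂ) = ∫ v in |l|⁻¹..1, ((v⁻¹ : ℝ) : ℂ) := by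
          rw [intervalIntegral.integral_ofReal, integral_inv_of_pos ha0 one_pos, one_div, inv_inv]
        rw [h2, ← intervalIntegral.integral_sub]
        · refine intervalIntegral.integral_congr fun v _ => ?_
          simp only [Complex.ofReal_inv]
          ring
        · exact (hcontc.mul (by fun_prop : Continuous fun v : ℝ =>
            Complex.exp (Complex.I * l * v)).continuousOn).intervalIntegrable
        · exact hcontc.intervalIntegrable
      rw [← h1, expIntegral, intervalIntegral.integral_add_adjacent_intervals
        (intervalIntegrable_exp_I_mul_mul_sub_one_div l _ _)
        (intervalIntegrable_exp_I_mul_mul_sub_one_div l _ _)]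
    have hA : ‖∫ v in (0 : ℝ)..|l|⁻¹, (Complex.exp (Complex.I * l * v) - 1) / (v : ℂ)‖ ≤ 1 := by
      have := intervalIntegral.norm_integral_le_of_norm_le_const (a := (0 : ℝ))
        (b := |l|⁻¹) (C := |l|)
        (f := fun v : ℝ => (Complex.exp (Complex.I * l * v) - 1) / (v : ℂ))
        fun v _ => norm_exp_I_mul_mul_sub_one_div_le l v
      rwa [sub_zero, abs_of_pos ha0, mul_inv_cancel₀ hl0.ne'] at this
    have hB := norm_integral_inv_mul_exp_le h
    have hC : ‖((Real.log (1 + |l|) - Real.log |l| : ℝ) : ℂ)‖ ≤ 1 := by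
      have h1 : Real.log |l| ≤ Real.log (1 + |l|) := Real.log_le_log hl0 (by linarith)
      have h2 : Real.log (1 + |l|) ≤ Real.log 2 + Real.log |l| := by
        rw [← Real.log_mul two_ne_zero hl0.ne']
        exact Real.log_le_log (by linarith) (by linarith)
      rw [Complex.norm_real, Real.norm_of_nonneg (by linarith)]
      linarith
    have heq : expIntegral l + (Real.log (1 + |l|) : ℂ) =
        (∫ v in (0 : ℝ)..|l|⁻¹, (Complex.exp (Complex.I * l * v) - 1) / (v : ℂ)) +
          (∫ v in |l|⁻¹..1, ((v⁻¹ : ℝ) : ℂ) * Complex.exp (Complex.I * l * v)) +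
          ((Real.log (1 + |l|) - Real.log |l| : ℝ) : ℂ) := by
      rw [hsplit]
      push_cast
      ring
    rw [heq]
    refine (norm_add₃_le).trans ?_
    linarith

/-! ### Euler products -/

theorem factorization_prod_primesLE {N : ℕ} (ν : Nat.primesLE N → ℕ) (q : Nat.primesLE N) :
    (∏ p : Nat.primesLE N, (p : ℕ) ^ ν p).factorization q = ν q := by
  have hp : ∀ p : Nat.primesLE N, (p : ℕ).Prime := fun p => Nat.prime_of_mem_primesLE p.2
  rw [Nat.factorization_prod_apply fun p _ => pow_ne_zero _ (hp p).ne_zero,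
    Finset.sum_eq_single q]
  · simp [(hp q).factorization_pow]
  · intro p _ hpq
    rw [(hp p).factorization_pow, Finsupp.single_eq_of_ne]
    exact fun h => hpq (Subtype.ext h.symm)
  · simp

/-- Unique factorization makes the parametrization by exponents injective, so the sum runs over
exponent tuples and factors. Multiplicativity is asked only away from `0`, where `log` is additive.
-/
theorem sum_ensemble_eq_prod (k N : ℕ) {F : ℕ → ℂ} (h1 : F 1 = 1)
    (hmul : ∀ a b : ℕ, a ≠ 0 → b ≠ 0 → F (a * b) = F a * F b) :
    ∑ x ∈ ensemble k N, F x = ∏ p ∈ N.primesLE, ∑ j ∈ Finset.range k, F p ^ j := by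
  have hp : ∀ p : Nat.primesLE N, (p : ℕ) ≠ 0 := fun p =>
    (Nat.prime_of_mem_primesLE p.2).ne_zero
  have hpow : ∀ a : ℕ, a ≠ 0 → ∀ j : ℕ, F (a ^ j) = F a ^ j := fun a ha j => by
    induction j with
    | zero => simp [h1]
    | succ j ih => rw [pow_succ, hmul _ _ (pow_ne_zero _ ha) ha, ih, pow_succ]
  have hprod : ∀ (ν : Nat.primesLE N → ℕ) (s : Finset (Nat.primesLE N)),
      F (∏ p ∈ s, (p : ℕ) ^ ν p) = ∏ p ∈ s, F p ^ ν p := fun ν s => by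
    classical
    induction s using Finset.induction_on with
    | empty => simp [h1]
    | insert a s ha ih =>
      rw [Finset.prod_insert ha, Finset.prod_insert ha,
        hmul _ _ (pow_ne_zero _ (hp a)) (Finset.prod_ne_zero_iff.2 fun p _ =>
          pow_ne_zero _ (hp p)), ih, hpow _ (hp a)]
  rw [ensemble, Finset.sum_image, ← Finset.prod_coe_sort, Finset.prod_univ_sum]
  · exact Finset.sum_congr rfl fun ν _ => hprod ν _
  · intro ν _ ν' _ h
    funext q
    have := congrArg (fun n => n.factorization q) h
    simpa only [factorization_prod_primesLE] using this

/-- The truncated geometric series, the local factor of the partition function. -/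
noncomputable def localFactor (k : ℕ) (z : ℂ) : ℂ :=
  ∑ j ∈ Finset.range k, z ^ j

theorem Z_eq_prod (k : ℕ) (α : ℂ) (N : ℕ) :
    Z k α N = ∏ p ∈ N.primesLE, localFactor k (α / p) := by
  rw [Z, P, sum_ensemble_eq_prod k N (F := fun x => α ^ ArithmeticFunction.cardFactors x / (x : ℂ))]
  · refine Finset.prod_congr rfl fun p hp => ?_
    simp [localFactor, ArithmeticFunction.cardFactors_apply_prime (Nat.prime_of_mem_primesLE hp)]
  · simp
  · intro a b ha hb
    simp only [ArithmeticFunction.cardFactors_mul ha hb, pow_add, Nat.cast_mul]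
    ring

theorem phiN_eq_prod_div (k : ℕ) (α : ℂ) (N : ℕ) (l : ℝ) :
    phiN k α N l = (∏ p ∈ N.primesLE,
      localFactor k (α / p * Complex.exp (Complex.I * l * xi N p))) /
      ∏ p ∈ N.primesLE, localFactor k (α / p) := by
  have h := sum_ensemble_eq_prod k N (F := fun x => Complex.exp (Complex.I * l * xi N x) *
    (α ^ ArithmeticFunction.cardFactors x / (x : ℂ))) (by simp [xi]) (by
      intro a b ha hb
      have hxi : xi N (a * b) = xi N a + xi N b := by
        simp only [xi, Nat.cast_mul]
        rw [Real.log_mul (Nat.cast_ne_zero.2 ha) (Nat.cast_ne_zero.2 hb), add_div]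
      simp only [hxi, ArithmeticFunction.cardFactors_mul ha hb, pow_add, Nat.cast_mul,
        Complex.ofReal_add, mul_add, Complex.exp_add]
      ring)
  rw [← Z_eq_prod, div_eq_inv_mul]
  have h2 : ∏ p ∈ N.primesLE, localFactor k (α / p * Complex.exp (Complex.I * l * xi N p)) =
      ∏ p ∈ N.primesLE, ∑ j ∈ Finset.range k, (Complex.exp (Complex.I * l * xi N p) *
        (α ^ ArithmeticFunction.cardFactors p / (p : ℂ))) ^ j :=
    Finset.prod_congr rfl fun p hp => by
      simp only [localFactor, pow_one, mul_comm (α / (p : ℂ)),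
        ArithmeticFunction.cardFactors_apply_prime (Nat.prime_of_mem_primesLE hp)]
  rw [h2, ← h, Finset.mul_sum, phiN]
  refine Finset.sum_congr rfl fun x _ => ?_
  rw [PN, P, Finset.sum_singleton]
  ring

/-! ### Logarithms of the local factors -/

/-- The logarithm of `localFactor k z`, minus its linear term. -/
noncomputable def localLog (k : ℕ) (z : ℂ) : ℂ :=
  Complex.log (1 - z ^ k) - Complex.log (1 - z) - z

theorem one_sub_mem_slitPlane {z : ℂ} (hz : ‖z‖ < 1) : 1 - z ∈ Complex.slitPlane := by
  rw [Complex.mem_slitPlane_iff]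
  left
  have := (Complex.abs_re_le_norm z)
  have := (abs_le.1 this).2
  simp only [Complex.sub_re, Complex.one_re]
  linarith

theorem norm_pow_lt_one {z : ℂ} (hz : ‖z‖ < 1) {k : ℕ} (hk : k ≠ 0) : ‖z ^ k‖ < 1 := by
  rw [norm_pow]
  exact pow_lt_one₀ (norm_nonneg z) hz hk

/-- The local factor is `(1 - z ^ k) / (1 - z)`, and both parts lie in the right half-plane, so
principal logarithms apply. -/
theorem exp_localLog_add {k : ℕ} (hk : k ≠ 0) {z : ℂ} (hz : ‖z‖ < 1) :
    Complex.exp (localLog k z + z) = localFactor k z := by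
  have h1 := Complex.slitPlane_ne_zero (one_sub_mem_slitPlane hz)
  have h2 := Complex.slitPlane_ne_zero (one_sub_mem_slitPlane (norm_pow_lt_one hz hk))
  rw [localLog, sub_add_cancel, Complex.exp_sub, Complex.exp_log h1, Complex.exp_log h2,
    localFactor, geom_sum_eq (fun h => h1 (by rw [h, sub_self])), ← neg_sub (z ^ k) 1,
    ← neg_sub z 1, neg_div_neg_eq]

theorem hasDerivAt_localLog {k : ℕ} (hk : k ≠ 0) {z : ℂ} (hz : ‖z‖ < 1) :
    HasDerivAt (localLog k) (-(k * z ^ (k - 1)) / (1 - z ^ k) - -1 / (1 - z) - 1) z :=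
  ((((hasDerivAt_pow k z).const_sub 1).clog
    (one_sub_mem_slitPlane (norm_pow_lt_one hz hk))).sub
    (((hasDerivAt_id z).const_sub 1).clog (one_sub_mem_slitPlane hz))).sub (hasDerivAt_id z)

/-- The derivative equals `z / (1 - z) - k z ^ (k - 1) / (1 - z ^ k)`, which vanishes at `0` because
`k ≥ 2`. -/
theorem norm_deriv_localLog_le {k : ℕ} (hk : 2 ≤ k) {z : ℂ} {r : ℝ} (hr : r < 1)
    (hz : ‖z‖ ≤ r) :
    ‖-(k * z ^ (k - 1)) / (1 - z ^ k) - -1 / (1 - z) - 1‖ ≤ (k + 1) / (1 - r) * ‖z‖ := by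
  have hz1 : ‖z‖ < 1 := hz.trans_lt hr
  have h1 := Complex.slitPlane_ne_zero (one_sub_mem_slitPlane hz1)
  have hr0 : 0 < 1 - r := by linarith
  have hle : ∀ j : ℕ, j ≠ 0 → ‖z ^ j‖ ≤ ‖z‖ := fun j hj => by
    rw [norm_pow]
    exact pow_le_of_le_one (norm_nonneg z) hz1.le hj
  have hden : ∀ j : ℕ, j ≠ 0 → 1 - r ≤ ‖1 - z ^ j‖ := fun j hj => by
    have := norm_sub_norm_le 1 (z ^ j)
    rw [norm_one] at this
    linarith [hle j hj]
  have heq : -(k * z ^ (k - 1)) / (1 - z ^ k) - -1 / (1 - z) - 1 =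
      z / (1 - z) - k * z ^ (k - 1) / (1 - z ^ k) := by
    field_simp
    ring
  rw [heq]
  refine (norm_sub_le _ _).trans ?_
  have hA : ‖z / (1 - z)‖ ≤ ‖z‖ / (1 - r) := by
    rw [norm_div]
    have := hden 1 one_ne_zero
    rw [pow_one] at this
    gcongr
  have hB : ‖k * z ^ (k - 1) / (1 - z ^ k)‖ ≤ k * ‖z‖ / (1 - r) := by
    rw [norm_div, norm_mul, Complex.norm_natCast]
    gcongr
    · exact hle _ (by omega)
    · exact hden k (by omega)
  refine (add_le_add hA hB).trans_eq ?_
  ring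

theorem norm_localLog_mul_sub_le {k : ℕ} (hk : 2 ≤ k) {z w : ℂ} {r : ℝ} (hr : r < 1)
    (hz : ‖z‖ ≤ r) (hw : ‖w‖ = 1) :
    ‖localLog k (z * w) - localLog k z‖ ≤ (k + 1) / (1 - r) * ‖z‖ ^ 2 * ‖w - 1‖ := by
  have hr0 : 0 < 1 - r := by linarith
  have := (convex_closedBall (0 : ℂ) ‖z‖).norm_image_sub_le_of_norm_hasDerivWithin_le
    (f := localLog k) (C := (k + 1) / (1 - r) * ‖z‖) (x := z) (y := z * w)
    (fun x hx => (hasDerivAt_localLog (by omega)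
      (((mem_closedBall_zero_iff.1 hx).trans hz).trans_lt hr)).hasDerivWithinAt)
    (fun x hx => (norm_deriv_localLog_le hk hr ((mem_closedBall_zero_iff.1 hx).trans hz)).trans
      (by
        have := mem_closedBall_zero_iff.1 hx
        gcongr))
    (by simp) (by simp [hw])
  refine this.trans_eq ?_
  rw [← mul_sub_one, norm_mul]
  ring

theorem norm_div_prime_le {N p : ℕ} (hp : p ∈ N.primesLE) (α : ℂ) :
    ‖α / (p : ℂ)‖ ≤ ‖α‖ / 2 := by
  have h2 : (2 : ℝ) ≤ p := by exact_mod_cast Nat.two_le_of_mem_primesLE hp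
  rw [norm_div, Complex.norm_natCast]
  gcongr

/-- The linear terms of the logarithms form `α * primeExpSum`; the rest is at most of order `∑ ‖w p
- 1‖ / p ^ 2`. Bounding `‖w p - 1‖` by `2` gives the uniform estimate needed for large `l`, and by
`|l| log p / log N` the small one. -/
theorem exists_phiN_eq_exp {k : ℕ} (hk : 2 ≤ k) {α : ℂ} (hα : ‖α‖ < 2) :
    ∃ C : ℝ, 0 ≤ C ∧ ∀ N : ℕ, 2 ≤ N → ∀ l : ℝ, ∃ r : ℂ,
      phiN k α N l = Complex.exp (α * primeExpSum N l + r) ∧ ‖r‖ ≤ C ∧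
        ‖r‖ ≤ C * (|l| / Real.log N) := by
  obtain ⟨D, hD0, hD⟩ := exists_sum_primesLE_log_div_mul_le
  have hlog2 : 1 / 2 ≤ Real.log 2 := by have := Real.log_two_gt_d9; linarith
  set K : ℝ := (k + 1) / (1 - ‖α‖ / 2) * ‖α‖ ^ 2 with hK
  have hK0 : 0 ≤ K := by
    have : 0 < 1 - ‖α‖ / 2 := by linarith
    positivity
  refine ⟨4 * K * D, by positivity, fun N hN l => ?_⟩
  have hN' : (2 : ℝ) ≤ N := by exact_mod_cast hN
  have hL : 0 < Real.log N := Real.log_pos (by linarith)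
  set w : ℕ → ℂ := fun p => Complex.exp (Complex.I * l * xi N p) with hw
  have hw1 : ∀ p, ‖w p‖ = 1 := fun p => norm_exp_I_mul_mul l _
  have hsmall : ∀ p ∈ N.primesLE, ‖α / (p : ℂ)‖ < 1 := fun p hp =>
    (norm_div_prime_le hp α).trans_lt (by linarith)
  have hterm : ∀ p ∈ N.primesLE,
      ‖localLog k (α / p * w p) - localLog k (α / p)‖ ≤
        K * (Real.log p / ((p : ℝ) * ((p : ℝ) - 1))) * (‖w p - 1‖ / Real.log p) := by
    intro p hp
    have h2 : (2 : ℝ) ≤ p := by exact_mod_cast Nat.two_le_of_mem_primesLE hp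
    have hp0 : (0 : ℝ) < p := by linarith
    have hlp : 0 < Real.log p := Real.log_pos (by linarith)
    refine (norm_localLog_mul_sub_le hk (by linarith) (norm_div_prime_le hp α)
      (hw1 p)).trans ?_
    have h3 : K * (Real.log p / ((p : ℝ) * ((p : ℝ) - 1))) * (‖w p - 1‖ / Real.log p) =
        K * (1 / ((p : ℝ) * ((p : ℝ) - 1))) * ‖w p - 1‖ := by
      have : (p : ℝ) - 1 ≠ 0 := by linarith
      field_simp
    have h4 : (k + 1) / (1 - ‖α‖ / 2) * ‖α / (p : ℂ)‖ ^ 2 = K * (1 / ((p : ℝ) * p)) := by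
      rw [hK, norm_div, Complex.norm_natCast]
      ring
    rw [h3, h4]
    have h5 : 0 < (p : ℝ) - 1 := by linarith
    gcongr
    linarith
  have hsum : ∀ B : ℝ, (∀ p ∈ N.primesLE, ‖w p - 1‖ / Real.log p ≤ B) →
      ‖∑ p ∈ N.primesLE, (localLog k (α / p * w p) - localLog k (α / p))‖ ≤ K * D * B := by
    intro B hB
    have hpos : ∀ p ∈ N.primesLE, 0 ≤ Real.log p / ((p : ℝ) * ((p : ℝ) - 1)) := fun p hp => by
      have h2 : (2 : ℝ) ≤ p := by exact_mod_cast Nat.two_le_of_mem_primesLE hp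
      have hlp : 0 < Real.log p := Real.log_pos (by linarith)
      have h3 : 0 ≤ (p : ℝ) - 1 := by linarith
      positivity
    have hB0 : 0 ≤ B := (div_nonneg (norm_nonneg _) (Real.log_natCast_nonneg 2)).trans
      (hB 2 (Nat.mem_primesLE.2 ⟨hN, Nat.prime_two⟩))
    calc _ ≤ ∑ p ∈ N.primesLE, K * (Real.log p / ((p : ℝ) * ((p : ℝ) - 1))) * B :=
          norm_sum_le_of_le _ fun p hp => (hterm p hp).trans
            (mul_le_mul_of_nonneg_left (hB p hp) (mul_nonneg hK0 (hpos p hp)))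
      _ = K * (∑ p ∈ N.primesLE, Real.log p / ((p : ℝ) * ((p : ℝ) - 1))) * B := by
          rw [← Finset.sum_mul, ← Finset.mul_sum]
      _ ≤ _ := by
          have := hD N
          gcongr
  refine ⟨∑ p ∈ N.primesLE, (localLog k (α / p * w p) - localLog k (α / p)), ?_, ?_, ?_⟩
  · have h1 : ∀ p ∈ N.primesLE, localFactor k (α / p) =
        Complex.exp (localLog k (α / p) + α / p) := fun p hp =>
      (exp_localLog_add (by omega) (hsmall p hp)).symm
    have h2 : ∀ p ∈ N.primesLE, localFactor k (α / p * w p) =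
        Complex.exp (localLog k (α / p * w p) + α / p * w p) := fun p hp =>
      (exp_localLog_add (by omega) (by rw [norm_mul, hw1, mul_one]; exact hsmall p hp)).symm
    rw [phiN_eq_prod_div, Finset.prod_congr rfl h1, Finset.prod_congr rfl h2,
      ← Complex.exp_sum, ← Complex.exp_sum, ← Complex.exp_sub, ← Finset.sum_sub_distrib,
      primeExpSum, Finset.mul_sum, ← Finset.sum_add_distrib]
    congr 1
    refine Finset.sum_congr rfl fun p _ => ?_
    simp only [hw]
    ring
  -- The value `4` comes from `‖w p - 1‖ ≤ 2` and `log p ≥ log 2 ≥ 1 / 2`.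
  · refine (hsum 4 fun p hp => ?_).trans_eq (by ring)
    have h2 : (2 : ℝ) ≤ p := by exact_mod_cast Nat.two_le_of_mem_primesLE hp
    have hlp : Real.log 2 ≤ Real.log p := Real.log_le_log two_pos h2
    rw [div_le_iff₀ (by linarith)]
    have := norm_sub_le (w p) 1
    rw [hw1, norm_one] at this
    linarith
  · refine (hsum (|l| / Real.log N) fun p hp => ?_).trans ?_
    · have h2 : (2 : ℝ) ≤ p := by exact_mod_cast Nat.two_le_of_mem_primesLE hp
      have hlp : 0 < Real.log p := Real.log_pos (by linarith)
      rw [div_le_iff₀ hlp]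
      refine (norm_exp_I_mul_mul_sub_one_le l (xi N p)).trans_eq ?_
      rw [xi, abs_of_pos (div_pos hlp hL)]
      ring
    · have : 0 ≤ K * D * (|l| / Real.log N) := by positivity
      linarith

/-! ### Bounds for the characteristic functions and their difference -/

theorem phi_eq_exp (α : ℂ) (l : ℝ) : phi α l = Complex.exp (α * expIntegral l) := rfl

theorem norm_expIntegral_sub_le (l m : ℝ) :
    ‖expIntegral l - expIntegral m‖ ≤ |l - m| := by
  rw [expIntegral, expIntegral, ← intervalIntegral.integral_sub
    (intervalIntegrable_exp_I_mul_mul_sub_one_div l _ _)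
    (intervalIntegrable_exp_I_mul_mul_sub_one_div m _ _)]
  have := intervalIntegral.norm_integral_le_of_norm_le_const (a := (0 : ℝ)) (b := 1)
    (C := |l - m|) (f := fun v : ℝ => (Complex.exp (Complex.I * l * v) - 1) / (v : ℂ) -
      (Complex.exp (Complex.I * m * v) - 1) / (v : ℂ)) fun v _ => ?_
  · simpa using this
  · have h1 : (Complex.exp (Complex.I * l * v) - 1) / (v : ℂ) -
        (Complex.exp (Complex.I * m * v) - 1) / (v : ℂ) = Complex.exp (Complex.I * m * v) *
          ((Complex.exp (Complex.I * (l - m : ℝ) * v) - 1) / (v : ℂ)) := by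
      have h2 : Complex.exp (Complex.I * l * v) =
          Complex.exp (Complex.I * m * v) * Complex.exp (Complex.I * (l - m : ℝ) * v) := by
        rw [← Complex.exp_add]
        push_cast
        ring_nf
      rw [h2]
      ring
    rw [h1, norm_mul, norm_exp_I_mul_mul, one_mul]
    exact norm_exp_I_mul_mul_sub_one_div_le _ _

theorem continuous_phi (α : ℂ) : Continuous (phi α) := by
  have h : Continuous expIntegral :=
    (LipschitzWith.of_dist_le_mul (K := 1) fun l m => by
      rw [dist_eq_norm, Real.dist_eq, NNReal.coe_one, one_mul]
      exact norm_expIntegral_sub_le l m).continuous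
  exact Complex.continuous_exp.comp (continuous_const.mul h)

theorem continuous_phiN (k : ℕ) (α : ℂ) (N : ℕ) : Continuous (phiN k α N) := by
  unfold phiN
  fun_prop

theorem exists_norm_phiN_le {k : ℕ} (hk : 2 ≤ k) {α : ℂ} (hα : ‖α‖ < 2) :
    ∃ C : ℝ, 0 < C ∧ ∀ N : ℕ, 2 ≤ N → ∀ l : ℝ,
      ‖phiN k α N l‖ ≤ C * Real.log N ^ (‖α‖ - α.re) := by
  obtain ⟨C₁, hC₁0, hC₁⟩ := exists_phiN_eq_exp hk hα
  obtain ⟨C₂, hC₂⟩ := exists_sum_primesLE_inv_le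
  have hc : 0 ≤ ‖α‖ - α.re := sub_nonneg.2 (Complex.re_le_norm α)
  refine ⟨Real.exp ((‖α‖ - α.re) * C₂ + C₁), Real.exp_pos _, fun N hN l => ?_⟩
  have hL : 0 < Real.log N := Real.log_pos (by exact_mod_cast hN)
  obtain ⟨r, hr, hr1, -⟩ := hC₁ N hN l
  have h1 : (α * primeExpSum N l).re ≤ (‖α‖ - α.re) * ∑ p ∈ N.primesLE, (p : ℝ)⁻¹ := by
    rw [primeExpSum, Finset.mul_sum, Finset.mul_sum, Complex.re_sum]
    refine Finset.sum_le_sum fun p _ => ?_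
    have h2 : α * ((Complex.exp (Complex.I * l * xi N p) - 1) / (p : ℂ)) =
        ((p : ℝ)⁻¹ : ℝ) * (α * Complex.exp (Complex.I * l * xi N p) - α) := by
      push_cast
      ring
    have h3 : (α * Complex.exp (Complex.I * l * xi N p)).re ≤ ‖α‖ := by
      refine (Complex.re_le_norm _).trans_eq ?_
      rw [norm_mul, norm_exp_I_mul_mul, mul_one]
    rw [h2, Complex.re_ofReal_mul, Complex.sub_re, mul_comm]
    gcongr
  rw [hr, Complex.norm_exp, Complex.add_re, Real.rpow_def_of_pos hL, ← Real.exp_add]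
  refine Real.exp_le_exp.2 ?_
  have h4 := (Complex.re_le_norm r).trans hr1
  have h5 := mul_le_mul_of_nonneg_left (hC₂ N hN) hc
  linarith

theorem norm_phi_le (α : ℂ) (l : ℝ) :
    ‖phi α l‖ ≤ Real.exp (5 * ‖α‖) * (1 + |l|) ^ (-α.re) := by
  have hl : 0 < 1 + |l| := by positivity
  rw [phi_eq_exp, Complex.norm_exp, Real.rpow_def_of_pos hl, ← Real.exp_add]
  refine Real.exp_le_exp.2 ?_
  have h1 := (Complex.re_le_norm (α * (expIntegral l + (Real.log (1 + |l|) : ℂ))))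
  rw [norm_mul, mul_add, Complex.add_re, Complex.re_mul_ofReal] at h1
  have h2 := mul_le_mul_of_nonneg_left (norm_expIntegral_add_log_le l) (norm_nonneg α)
  linarith

theorem norm_exp_sub_one_le_mul_exp (z : ℂ) :
    ‖Complex.exp z - 1‖ ≤ ‖z‖ * Real.exp ‖z‖ := by
  simpa using Complex.norm_exp_sub_sum_le_norm_mul_exp z 1

/-- Write `phiN = phi * exp δ` with `‖δ‖ ≤ K (|l| / log N) (1 + log (1 + |l|))`. The choice `ρ = τ /
K` forces `exp ‖δ‖ ≤ e ^ τ (1 + |l|) ^ τ`; a second factor `(1 + |l|) ^ τ` absorbs the logarithm in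
`‖δ‖`, whence `2τ`. -/
theorem exists_norm_phiN_sub_phi_le {k : ℕ} (hk : 2 ≤ k) {α : ℂ} (hα : ‖α‖ < 2)
    {τ : ℝ} (hτ : 0 < τ) :
    ∃ C ρ : ℝ, 0 ≤ C ∧ 0 < ρ ∧ ∀ N : ℕ, 2 ≤ N → ∀ l : ℝ, |l| / Real.log N ≤ ρ →
      ‖phiN k α N l - phi α l‖ ≤ C / Real.log N * (1 + |l|) ^ (1 - α.re + 2 * τ) := by
  obtain ⟨C₁, hC₁0, hC₁⟩ := exists_phiN_eq_exp hk hα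
  obtain ⟨C₂, hC₂0, hC₂⟩ := exists_norm_primeExpSum_sub_expIntegral_le
  set K : ℝ := ‖α‖ * C₂ + C₁ + 1 with hK
  have hK0 : 0 < K := by positivity
  refine ⟨Real.exp (5 * ‖α‖) * (K * (1 + 1 / τ) * Real.exp τ), τ / K, by positivity,
    by positivity, fun N hN l hlN => ?_⟩
  have hL : 0 < Real.log N := Real.log_pos (by exact_mod_cast hN)
  have hl : 0 < 1 + |l| := by positivity
  have hlog : 0 ≤ Real.log (1 + |l|) := Real.log_nonneg (by have := abs_nonneg l; linarith)
  obtain ⟨r, hr, -, hr1⟩ := hC₁ N hN l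
  set δ : ℂ := α * (primeExpSum N l - expIntegral l) + r with hδ
  have hq : 0 ≤ |l| / Real.log N := by positivity
  have hδle : ‖δ‖ ≤ K * (|l| / Real.log N) * (1 + Real.log (1 + |l|)) := by
    refine (norm_add_le _ _).trans ?_
    rw [norm_mul]
    have h1 := mul_le_mul_of_nonneg_left (hC₂ N hN l) (norm_nonneg α)
    have h2 : C₁ * (|l| / Real.log N) ≤ (C₁ + 1) * (|l| / Real.log N) *
        (1 + Real.log (1 + |l|)) := by
      have h3 : 0 ≤ (C₁ + 1) * (|l| / Real.log N) := by positivity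
      nlinarith [mul_nonneg h3 hlog]
    calc _ ≤ ‖α‖ * (C₂ * (|l| / Real.log N * (1 + Real.log (1 + |l|)))) +
          (C₁ + 1) * (|l| / Real.log N) * (1 + Real.log (1 + |l|)) := by linarith
      _ = _ := by rw [hK]; ring
  have hδτ : ‖δ‖ ≤ τ + Real.log (1 + |l|) * τ := by
    have h1 : K * (|l| / Real.log N) ≤ τ := by
      rw [mul_comm]
      exact (le_div_iff₀ hK0).1 hlN
    calc _ ≤ _ := hδle
      _ ≤ τ * (1 + Real.log (1 + |l|)) := by gcongr
      _ = _ := by ring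
  have hexp : Real.exp ‖δ‖ ≤ Real.exp τ * (1 + |l|) ^ τ := by
    rw [Real.rpow_def_of_pos hl, ← Real.exp_add]
    exact Real.exp_le_exp.2 hδτ
  have hlogτ : 1 + Real.log (1 + |l|) ≤ (1 + 1 / τ) * (1 + |l|) ^ τ := by
    have h1 := Real.log_le_rpow_div hl.le hτ
    have h2 : 1 ≤ (1 + |l|) ^ τ :=
      Real.one_le_rpow (by have := abs_nonneg l; linarith) hτ.le
    calc _ ≤ (1 + |l|) ^ τ + (1 + |l|) ^ τ / τ := add_le_add h2 h1
      _ = _ := by ring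
  have hphi : phiN k α N l - phi α l = phi α l * (Complex.exp δ - 1) := by
    rw [hr, phi_eq_exp, mul_sub, ← Complex.exp_add, mul_one, hδ]
    ring_nf
  rw [hphi, norm_mul]
  calc _ ≤ Real.exp (5 * ‖α‖) * (1 + |l|) ^ (-α.re) * (K * (|l| / Real.log N) *
        ((1 + 1 / τ) * (1 + |l|) ^ τ) * (Real.exp τ * (1 + |l|) ^ τ)) := by
        refine mul_le_mul (norm_phi_le α l) ((norm_exp_sub_one_le_mul_exp δ).trans ?_)
          (norm_nonneg _) (by positivity)
        have h1 : ‖δ‖ ≤ K * (|l| / Real.log N) * ((1 + 1 / τ) * (1 + |l|) ^ τ) :=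
          hδle.trans (by gcongr)
        exact mul_le_mul h1 hexp (Real.exp_pos _).le (by positivity)
    _ ≤ Real.exp (5 * ‖α‖) * (1 + |l|) ^ (-α.re) * (K * ((1 + |l|) / Real.log N) *
        ((1 + 1 / τ) * (1 + |l|) ^ τ) * (Real.exp τ * (1 + |l|) ^ τ)) := by
        gcongr
        linarith
    _ = _ := by
        have : (1 + |l|) ^ (1 - α.re + 2 * τ) =
            (1 + |l|) ^ (1 : ℝ) * (1 + |l|) ^ (-α.re) * ((1 + |l|) ^ τ * (1 + |l|) ^ τ) := by
          rw [← Real.rpow_add hl, ← Real.rpow_add hl, ← Real.rpow_add hl]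
          ring_nf
        rw [this, Real.rpow_one]
        ring

/-! ### Integrals of powers, decay and integrability -/

theorem setIntegral_comp_abs {A : Set ℝ} (hA : MeasurableSet A) (F : ℝ → ℝ) :
    ∫ l in {l : ℝ | |l| ∈ A}, F |l| = 2 * ∫ x in A ∩ Set.Ioi 0, F x := by
  have h1 : MeasurableSet {l : ℝ | |l| ∈ A} := hA.preimage continuous_abs.measurable
  rw [← integral_indicator h1, Set.inter_comm,
    ← setIntegral_indicator hA, ← integral_comp_abs (f := A.indicator F)]
  rfl

theorem integrable_one_add_abs_rpow {s : ℝ} (hs : s < -1) :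
    Integrable fun l : ℝ => (1 + |l|) ^ s := by
  have := integrable_one_add_norm (E := ℝ) (μ := volume) (r := -s) (by simp; linarith)
  simpa using this

theorem setIntegral_lt_abs_one_add_rpow_le {η R : ℝ} (hη : 1 < η) (hR : 0 < R) :
    ∫ l in {l : ℝ | R < |l|}, (1 + |l|) ^ (-η) ≤ 2 / (η - 1) * R ^ (1 - η) := by
  have h := setIntegral_comp_abs (A := Set.Ioi R) measurableSet_Ioi fun x => (1 + x) ^ (-η)
  have h0 : Set.Ioi R ∩ Set.Ioi 0 = Set.Ioi R :=
    Set.inter_eq_left.2 (Set.Ioi_subset_Ioi hR.le)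
  rw [h0] at h
  refine h.trans_le ?_
  have h1 : ∫ x in Set.Ioi R, (1 + x) ^ (-η) ≤ ∫ x in Set.Ioi R, x ^ (-η) := by
    have hint := integrableOn_Ioi_rpow_of_lt (a := -η) (by linarith) hR
    have hle : ∀ x ∈ Set.Ioi R, (1 + x) ^ (-η) ≤ x ^ (-η) := fun x hx =>
      Real.rpow_le_rpow_of_nonpos (hR.trans hx) (by linarith) (by linarith)
    refine setIntegral_mono_on (hint.mono'
      (by fun_prop : Measurable fun x : ℝ => (1 + x) ^ (-η)).aestronglyMeasurable ?_) hint measurableSet_Ioi hle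
    refine ae_restrict_of_forall_mem measurableSet_Ioi fun x hx => ?_
    have hx0 : 0 < x := hR.trans hx
    rw [Real.norm_of_nonneg (by positivity)]
    exact hle x hx
  rw [integral_Ioi_rpow_of_lt (by linarith) hR] at h1
  have h2 : -R ^ (-η + 1) / (-η + 1) = 1 / (η - 1) * R ^ (1 - η) := by
    rw [show -η + 1 = -(η - 1) by ring, neg_div_neg_eq, show 1 - η = -(η - 1) by ring]
    ring
  rw [h2] at h1
  calc _ ≤ 2 * (1 / (η - 1) * R ^ (1 - η)) := by gcongr
    _ = _ := by ring

theorem integrableOn_abs_le_one_add_rpow (s R : ℝ) :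
    IntegrableOn (fun l : ℝ => (1 + |l|) ^ s) {l : ℝ | |l| ≤ R} := by
  have h : {l : ℝ | |l| ≤ R} = Set.Icc (-R) R := by
    ext l
    exact abs_le (a := l)
  rw [h]
  refine (Continuous.continuousOn ?_).integrableOn_Icc
  exact (by fun_prop : Continuous fun l : ℝ => 1 + |l|).rpow_const
    fun l => Or.inl (by positivity)

theorem setIntegral_abs_le_one_add_rpow_le {s R : ℝ} (hs : -1 < s) (hR : 1 ≤ R) :
    ∫ l in {l : ℝ | |l| ≤ R}, (1 + |l|) ^ s ≤ 2 * 2 ^ (s + 1) / (s + 1) * R ^ (s + 1) := by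
  have h := setIntegral_comp_abs (A := Set.Iic R) measurableSet_Iic fun x => (1 + x) ^ s
  have h0 : Set.Iic R ∩ Set.Ioi 0 = Set.Ioc 0 R := by
    ext x
    simp [and_comm]
  rw [h0, ← intervalIntegral.integral_of_le (by linarith),
    intervalIntegral.integral_comp_add_left (fun x => x ^ s), integral_rpow (Or.inl hs)] at h
  refine h.trans_le ?_
  have hs0 : 0 < s + 1 := by linarith
  have h1 : (1 + R) ^ (s + 1) ≤ 2 ^ (s + 1) * R ^ (s + 1) := by
    rw [← Real.mul_rpow two_pos.le (by linarith)]
    exact Real.rpow_le_rpow (by linarith) (by linarith) hs0.le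
  have h2 : 0 ≤ (1 + (0 : ℝ)) ^ (s + 1) := by positivity
  calc _ ≤ 2 * ((2 ^ (s + 1) * R ^ (s + 1)) / (s + 1)) := by
        gcongr
        linarith
    _ = _ := by ring

theorem div_one_add_rpow_le {C η x : ℝ} (hC : 0 ≤ C) (hη : 0 ≤ η) (hx : 0 ≤ x) :
    C / (1 + x ^ η) ≤ C * 2 ^ η * (1 + x) ^ (-η) := by
  have h0 : 0 ≤ x ^ η := Real.rpow_nonneg hx η
  have h1 : (1 + x) ^ η ≤ 2 ^ η * (1 + x ^ η) := by
    rcases le_total x 1 with h | h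
    · calc (1 + x) ^ η ≤ 2 ^ η := Real.rpow_le_rpow (by linarith) (by linarith) hη
        _ ≤ _ := le_mul_of_one_le_right (by positivity) (by linarith)
    · calc (1 + x) ^ η ≤ (2 * x) ^ η := Real.rpow_le_rpow (by linarith) (by linarith) hη
        _ = 2 ^ η * x ^ η := Real.mul_rpow two_pos.le hx
        _ ≤ _ := by gcongr; linarith
  rw [Real.rpow_neg (by linarith), ← div_eq_mul_inv, div_le_div_iff₀ (by positivity)
    (by positivity)]
  calc C * (1 + x) ^ η ≤ C * (2 ^ η * (1 + x ^ η)) := by gcongr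
    _ = _ := by ring

theorem exists_ae_norm_le_of_mem_S {η : ℝ} (hη : 0 ≤ η) {f fhat : ℝ → ℂ} (hf : f ∈ S η)
    (hfhat : HasFourierTransform f fhat) :
    ∃ D : ℝ, 0 ≤ D ∧ ∀ᵐ l, ‖fhat l‖ ≤ D * (1 + |l|) ^ (-η) := by
  obtain ⟨g, hg, C, hC, hgC⟩ := hf
  refine ⟨C * 2 ^ η, by positivity, ?_⟩
  filter_upwards [hfhat.ae_eq hg] with l hl
  rw [hl]
  exact (hgC l).trans (div_one_add_rpow_le hC.le hη (abs_nonneg l))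

theorem integrable_of_ae_norm_le {η D : ℝ} (hη : 1 < η) {g : ℝ → ℂ}
    (hg : AEStronglyMeasurable g) (hD : ∀ᵐ l, ‖g l‖ ≤ D * (1 + |l|) ^ (-η)) :
    Integrable g :=
  ((integrable_one_add_abs_rpow (by linarith)).const_mul D).mono' hg hD

theorem integrable_phiN_mul {k : ℕ} (hk : 2 ≤ k) {α : ℂ} (hα : ‖α‖ < 2) {g : ℝ → ℂ}
    (hg : Integrable g) {N : ℕ} (hN : 2 ≤ N) :
    Integrable fun l : ℝ => phiN k α N l * g l := by
  obtain ⟨C, -, hC⟩ := exists_norm_phiN_le hk hα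
  exact hg.bdd_mul (continuous_phiN k α N).aestronglyMeasurable (ae_of_all _ (hC N hN))

theorem integrableOn_phi_mul (α : ℂ) {g : ℝ → ℂ} (hg : Integrable g) (R : ℝ) :
    IntegrableOn (fun l : ℝ => phi α l * g l) {l : ℝ | |l| ≤ R} := by
  have h : {l : ℝ | |l| ≤ R} = Set.Icc (-R) R := by
    ext l
    exact abs_le (a := l)
  rw [h]
  obtain ⟨C, hC⟩ := isCompact_Icc.exists_bound_of_continuousOn
    (continuous_phi α).continuousOn (s := Set.Icc (-R) R)
  exact hg.integrableOn.bdd_mul (continuous_phi α).aestronglyMeasurable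
    (ae_restrict_of_forall_mem measurableSet_Icc hC)

/-! ### The tail and the central range -/

theorem norm_integral_phiN_mul_lt_abs_le {k : ℕ} (hk : 2 ≤ k) {α : ℂ} (hα : ‖α‖ < 2)
    {η D : ℝ} (hη : 1 < η) {g : ℝ → ℂ} (hD0 : 0 ≤ D)
    (hD : ∀ᵐ l, ‖g l‖ ≤ D * (1 + |l|) ^ (-η)) :
    ∃ C : ℝ, ∀ N : ℕ, 2 ≤ N → ∀ R : ℝ, 0 < R →
      ‖∫ l in {l : ℝ | R < |l|}, phiN k α N l * g l‖ ≤
        C * (Real.log N ^ (‖α‖ - α.re) / R ^ (η - 1)) := by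
  obtain ⟨C, hC0, hC⟩ := exists_norm_phiN_le hk hα
  refine ⟨C * D * (2 / (η - 1)), fun N hN R hR => ?_⟩
  have hL : 0 < Real.log N := Real.log_pos (by exact_mod_cast hN)
  have h1 : ‖∫ l in {l : ℝ | R < |l|}, phiN k α N l * g l‖ ≤
      ∫ l in {l : ℝ | R < |l|}, C * Real.log N ^ (‖α‖ - α.re) * (D * (1 + |l|) ^ (-η)) := by
    refine norm_integral_le_of_norm_le
      (((integrable_one_add_abs_rpow (by linarith)).const_mul D).const_mul _).integrableOn
      (ae_restrict_of_ae ?_)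
    filter_upwards [hD] with l hl
    rw [norm_mul]
    have := hC N hN l
    gcongr
  refine h1.trans ?_
  rw [integral_const_mul, integral_const_mul]
  have h2 := setIntegral_lt_abs_one_add_rpow_le hη hR
  calc _ ≤ C * Real.log N ^ (‖α‖ - α.re) * (D * (2 / (η - 1) * R ^ (1 - η))) := by gcongr
    _ = _ := by
      rw [show 1 - η = -(η - 1) by ring, Real.rpow_neg hR.le]
      ring

theorem phiN_zero {k : ℕ} (hk : 2 ≤ k) (N : ℕ) (l : ℝ) : phiN k 0 N l = 1 := by
  have h : localFactor k 0 = 1 := by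
    rw [← exp_localLog_add (by omega) (by simp)]
    simp [localLog, zero_pow (show k ≠ 0 by omega)]
  rw [phiN_eq_prod_div]
  simp [h]

theorem phi_zero (l : ℝ) : phi 0 l = 1 := by
  rw [phi_eq_exp, zero_mul, Complex.exp_zero]

theorem exists_norm_integral_phiN_sub_phi_mul_le {k : ℕ} (hk : 2 ≤ k) {α : ℂ} (hα : ‖α‖ < 2)
    {η D τ : ℝ} (hτ : 0 < τ) {g : ℝ → ℂ} (hD0 : 0 ≤ D)
    (hD : ∀ᵐ l, ‖g l‖ ≤ D * (1 + |l|) ^ (-η)) :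
    ∃ C ρ : ℝ, 0 ≤ C ∧ 0 < ρ ∧ ∀ N : ℕ, 2 ≤ N → ∀ R : ℝ, R / Real.log N ≤ ρ →
      ‖∫ l in {l : ℝ | |l| ≤ R}, (phiN k α N l - phi α l) * g l‖ ≤
        C / Real.log N * ∫ l in {l : ℝ | |l| ≤ R}, (1 + |l|) ^ (1 - α.re + 2 * τ - η) := by
  obtain ⟨C, ρ, hC0, hρ0, hC⟩ := exists_norm_phiN_sub_phi_le hk hα hτ
  refine ⟨C * D, ρ, by positivity, hρ0, fun N hN R hR => ?_⟩
  have hL : 0 < Real.log N := Real.log_pos (by exact_mod_cast hN)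
  rw [← integral_const_mul]
  have hmeas : MeasurableSet {l : ℝ | |l| ≤ R} :=
    measurableSet_le continuous_abs.measurable measurable_const
  refine norm_integral_le_of_norm_le ((integrableOn_abs_le_one_add_rpow _ R).const_mul _) ?_
  filter_upwards [ae_restrict_of_ae hD, ae_restrict_mem hmeas] with l hl hlR
  have hl0 : 0 < 1 + |l| := by positivity
  have h1 := hC N hN l ((div_le_div_of_nonneg_right hlR hL.le).trans hR)
  rw [norm_mul]
  calc _ ≤ C / Real.log N * (1 + |l|) ^ (1 - α.re + 2 * τ) * (D * (1 + |l|) ^ (-η)) := by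
        gcongr
    _ = _ := by
        rw [show 1 - α.re + 2 * τ - η = 1 - α.re + 2 * τ + -η by ring,
          Real.rpow_add hl0 (1 - α.re + 2 * τ)]
        ring

/-- The threshold is `η = 2 + (‖α‖ - Re α)`. From there on, `τ = ‖α‖ / 4` makes the integrand
integrable on the whole line. Below it, `τ = ‖α‖ / 2` gives a positive power of `R`, dominated by
the tail error. -/
theorem isBigO_integral_phiN_sub_phi_mul {k : ℕ} (hk : 2 ≤ k) {α : ℂ} (hα : ‖α‖ < 2)
    {η D : ℝ} (hη : 1 < η) {g : ℝ → ℂ} (hD0 : 0 ≤ D)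
    (hD : ∀ᵐ l, ‖g l‖ ≤ D * (1 + |l|) ^ (-η)) {R : ℕ → ℝ} (hR1 : ∀ᶠ N in atTop, 1 ≤ R N)
    (hR : Tendsto (fun N : ℕ => R N / Real.log N) atTop (𝓝 0)) :
    ((fun N : ℕ => ∫ l in {l : ℝ | |l| ≤ R N}, (phiN k α N l - phi α l) * g l)
        =O[atTop] fun N : ℕ => 1 / Real.log N) ∨
      ((fun N : ℕ => ∫ l in {l : ℝ | |l| ≤ R N}, (phiN k α N l - phi α l) * g l)
        =O[atTop] fun N : ℕ => Real.log N ^ (‖α‖ - α.re) / R N ^ (η - 1)) := by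
  -- Both choices of `τ` are multiples of `‖α‖` and must be positive; for `α = 0` the two
  -- characteristic functions are identically `1`.
  rcases eq_or_ne α 0 with rfl | hα0
  · left
    simp only [phiN_zero hk, phi_zero, sub_self, zero_mul, integral_zero]
    exact isBigO_zero _ _
  have hpos : 0 < ‖α‖ := norm_pos_iff.2 hα0
  rcases lt_or_ge η (2 + (‖α‖ - α.re)) with hη2 | hη2
  · right
    obtain ⟨C, ρ, hC0, hρ0, hC⟩ := exists_norm_integral_phiN_sub_phi_mul_le hk hα
      (half_pos hpos) hD0 hD
    set s : ℝ := 1 - α.re + 2 * (‖α‖ / 2) - η with hs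
    have hs1 : -1 < s := by linarith
    refine IsBigO.of_bound (C * (2 * 2 ^ (s + 1) / (s + 1))) ?_
    filter_upwards [eventually_ge_atTop 2, hR1, hR.eventually_le_const hρ0,
      hR.eventually_le_const one_pos] with N hN hR1 hRρ hRL
    have hL : 0 < Real.log N := Real.log_pos (by exact_mod_cast hN)
    have hR0 : 0 < R N := by linarith
    have hs0 : 0 < s + 1 := by linarith
    have hc : 0 ≤ ‖α‖ - α.re := sub_nonneg.2 (Complex.re_le_norm α)
    have hRL' : R N ≤ Real.log N := (div_le_one hL).1 hRL
    -- With this `τ` the exponents satisfy `s + 1 + (η - 1) = ‖α‖ - Re α + 1`, so cross-multiplying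
    -- reduces the claim to `R N ≤ log N`.
    have h1 : R N ^ (s + 1) / Real.log N ≤ Real.log N ^ (‖α‖ - α.re) / R N ^ (η - 1) := by
      rw [div_le_div_iff₀ hL (by positivity), ← Real.rpow_add hR0, ← Real.rpow_add_one hL.ne',
        show s + 1 + (η - 1) = ‖α‖ - α.re + 1 by rw [hs]; ring]
      exact Real.rpow_le_rpow hR0.le hRL' (by linarith)
    rw [Real.norm_of_nonneg (by positivity)]
    calc _ ≤ _ := hC N hN (R N) hRρ
      _ ≤ C / Real.log N * (2 * 2 ^ (s + 1) / (s + 1) * R N ^ (s + 1)) := by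
        have := setIntegral_abs_le_one_add_rpow_le hs1 hR1
        gcongr
      _ = C * (2 * 2 ^ (s + 1) / (s + 1)) * (R N ^ (s + 1) / Real.log N) := by ring
      _ ≤ _ := by gcongr
  · left
    obtain ⟨C, ρ, hC0, hρ0, hC⟩ := exists_norm_integral_phiN_sub_phi_mul_le hk hα
      (τ := ‖α‖ / 4) (by positivity) hD0 hD
    set s : ℝ := 1 - α.re + 2 * (‖α‖ / 4) - η with hs
    have hs1 : s < -1 := by linarith
    refine IsBigO.of_bound (C * ∫ l : ℝ, (1 + |l|) ^ s) ?_
    filter_upwards [eventually_ge_atTop 2, hR.eventually_le_const hρ0] with N hN hRρ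
    have hL : 0 < Real.log N := Real.log_pos (by exact_mod_cast hN)
    rw [Real.norm_of_nonneg (by positivity)]
    calc _ ≤ _ := hC N hN (R N) hRρ
      _ ≤ C / Real.log N * ∫ l : ℝ, (1 + |l|) ^ s := by
        have := setIntegral_le_integral (s := {l : ℝ | |l| ≤ R N})
          (integrable_one_add_abs_rpow hs1) (ae_of_all _ fun l => by positivity)
        gcongr
      _ = _ := by ring

theorem tendsto_log_natCast_atTop : Tendsto (fun N : ℕ => Real.log N) atTop atTop :=
  Real.tendsto_log_atTop.comp tendsto_natCast_atTop_atTop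

/-- As `log N ^ c ≥ 1` eventually, the quotient can be below `1` only if `R N ^ (η - 1) > 1`. This
rules out `η = 1`, the borderline case `c = 0`. -/
theorem one_lt_and_eventually_one_le {c η : ℝ} (hc : 0 ≤ c) (hη : c + 1 ≤ η) {R : ℕ → ℝ}
    (hRpos : ∀ᶠ N in atTop, 0 < R N)
    (hR : Tendsto (fun N : ℕ => Real.log N ^ c / R N ^ (η - 1)) atTop (𝓝 0)) :
    1 < η ∧ ∀ᶠ N in atTop, 1 ≤ R N := by
  have hev : ∀ᶠ N : ℕ in atTop, 0 < R N ∧ 1 < R N ^ (η - 1) := by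
    filter_upwards [hRpos, hR.eventually_lt_const one_pos,
      tendsto_log_natCast_atTop.eventually_ge_atTop 1] with N h0 h1 hL
    refine ⟨h0, ?_⟩
    rw [div_lt_one (by positivity)] at h1
    exact (Real.one_le_rpow hL hc).trans_lt h1
  have hη1 : 1 < η := by
    obtain ⟨N, -, hN⟩ := hev.exists
    refine lt_of_le_of_ne (by linarith) fun h => ?_
    rw [← h, sub_self, Real.rpow_zero] at hN
    exact lt_irrefl _ hN
  refine ⟨hη1, hev.mono fun N hN => ?_⟩
  by_contra! h
  exact absurd hN.2 (not_lt.2 (Real.rpow_le_one hN.1.le h.le (by linarith)))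

end SmoothSums

/-! ### The main theorem -/

theorem mainTheorem3 (k : ℕ) (hk : 2 ≤ k) (α : ℂ) (hα : ‖α‖ < 2)
    (η : ℝ) (hη : ‖α‖ - α.re + 1 ≤ η)
    (f : ℝ → ℂ) (hf : f ∈ SmoothSums.S η)
    (fhat : ℝ → ℂ) (hfhat : SmoothSums.HasFourierTransform f fhat)
    (R : ℕ → ℝ) (hRpos : ∀ᶠ N in atTop, 0 < R N)
    (hR : Tendsto (fun N : ℕ => R N / Real.log N) atTop (𝓝 0))
    (hR' : Tendsto (fun N : ℕ => Real.log N ^ (‖α‖ - α.re) / R N ^ (η - 1)) atTop (𝓝 0)) :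
    (∀ N : ℕ, 2 ≤ N → Integrable fun l : ℝ => SmoothSums.phiN k α N l * fhat l) ∧
    (∀ N : ℕ, 2 ≤ N →
      IntegrableOn (fun l : ℝ => SmoothSums.phi α l * fhat l) {l : ℝ | |l| ≤ R N}) ∧
    ∃ ε : ℕ → ℂ,
      (∀ N : ℕ, 2 ≤ N →
        ∫ l : ℝ, SmoothSums.phiN k α N l * fhat l =
          (∫ l in {l : ℝ | |l| ≤ R N}, SmoothSums.phi α l * fhat l) + ε N) ∧
      Tendsto ε atTop (𝓝 0) ∧
      ∃ E₁ E₂ : ℕ → ℂ, (∀ N : ℕ, ε N = E₁ N + E₂ N) ∧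
        E₁ =O[atTop] (fun N : ℕ => Real.log (Real.log N) / Real.log N) ∧
        E₂ =O[atTop] (fun N : ℕ => Real.log N ^ (‖α‖ - α.re) / R N ^ (η - 1)) := by
  have hc : 0 ≤ ‖α‖ - α.re := sub_nonneg.2 (Complex.re_le_norm α)
  obtain ⟨hη1, hR1⟩ := SmoothSums.one_lt_and_eventually_one_le hc hη hRpos hR'
  obtain ⟨D, hD0, hD⟩ := SmoothSums.exists_ae_norm_le_of_mem_S (by linarith) hf hfhat
  have hint : Integrable fhat := SmoothSums.integrable_of_ae_norm_le hη1
    hfhat.locallyIntegrable.aestronglyMeasurable hD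
  have hN : ∀ N : ℕ, 2 ≤ N → Integrable fun l : ℝ => SmoothSums.phiN k α N l * fhat l :=
    fun N h => SmoothSums.integrable_phiN_mul hk hα hint h
  have hphi : ∀ N : ℕ,
      IntegrableOn (fun l : ℝ => SmoothSums.phi α l * fhat l) {l : ℝ | |l| ≤ R N} :=
    fun N => SmoothSums.integrableOn_phi_mul α hint (R N)
  refine ⟨hN, fun N _ => hphi N, ?_⟩
  set T : ℕ → ℂ := fun N => ∫ l in {l : ℝ | R N < |l|}, SmoothSums.phiN k α N l * fhat l with hT
  set ε : ℕ → ℂ := fun N => (∫ l : ℝ, SmoothSums.phiN k α N l * fhat l) -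
    ∫ l in {l : ℝ | |l| ≤ R N}, SmoothSums.phi α l * fhat l with hε
  have hTO : T =O[atTop] fun N : ℕ => Real.log N ^ (‖α‖ - α.re) / R N ^ (η - 1) := by
    obtain ⟨C, hC⟩ := SmoothSums.norm_integral_phiN_mul_lt_abs_le hk hα hη1 hD0 hD
    refine IsBigO.of_bound C ?_
    filter_upwards [eventually_ge_atTop 2, hRpos] with N h2 h0
    have hL : 0 < Real.log N := Real.log_pos (by exact_mod_cast h2)
    rw [Real.norm_of_nonneg (by positivity)]
    exact hC N h2 (R N) h0
  have hsub : (fun N : ℕ => ∫ l in {l : ℝ | |l| ≤ R N},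
      (SmoothSums.phiN k α N l - SmoothSums.phi α l) * fhat l) =ᶠ[atTop] fun N => ε N - T N := by
    filter_upwards [eventually_ge_atTop 2] with N h2
    have hmeas : MeasurableSet {l : ℝ | |l| ≤ R N} :=
      measurableSet_le continuous_abs.measurable measurable_const
    have hcompl : {l : ℝ | |l| ≤ R N}ᶜ = {l : ℝ | R N < |l|} := by
      ext l
      simp
    have h1 := integral_add_compl hmeas (hN N h2)
    rw [hcompl] at h1
    simp only [sub_mul]
    rw [integral_sub (hN N h2).integrableOn (hphi N), hε, hT]
    simp only [← h1]
    ring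
  have hlog := SmoothSums.tendsto_log_natCast_atTop
  have hloglog : (fun N : ℕ => 1 / Real.log N) =O[atTop]
      fun N : ℕ => Real.log (Real.log N) / Real.log N := by
    refine IsBigO.of_bound 1 ?_
    filter_upwards [(Real.tendsto_log_atTop.comp hlog).eventually_ge_atTop 1,
      hlog.eventually_gt_atTop 0] with N h1 h0
    have h1' : 1 ≤ Real.log (Real.log N) := h1
    rw [one_mul, Real.norm_of_nonneg (by positivity), Real.norm_of_nonneg (by positivity)]
    gcongr
  have hlim : Tendsto (fun N : ℕ => Real.log (Real.log N) / Real.log N) atTop (𝓝 0) :=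
    (Real.isLittleO_log_id_atTop.tendsto_div_nhds_zero).comp hlog
  obtain ⟨E₁, E₂, hE, hE₁, hE₂⟩ : ∃ E₁ E₂ : ℕ → ℂ, (∀ N : ℕ, ε N = E₁ N + E₂ N) ∧
      E₁ =O[atTop] (fun N : ℕ => Real.log (Real.log N) / Real.log N) ∧
      E₂ =O[atTop] (fun N : ℕ => Real.log N ^ (‖α‖ - α.re) / R N ^ (η - 1)) := by
    rcases SmoothSums.isBigO_integral_phiN_sub_phi_mul hk hα hη1 hD0 hD hR1 hR with h | h
    · exact ⟨fun N => ε N - T N, T, fun N => (sub_add_cancel _ _).symm,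
        (h.congr' hsub EventuallyEq.rfl).trans hloglog, hTO⟩
    -- Here the central error is of the order of the tail, so the whole of `ε` goes into the second
    -- term.
    · refine ⟨fun _ => 0, ε, fun N => (zero_add _).symm, isBigO_zero _ _, ?_⟩
      simpa only [sub_add_cancel] using (h.congr' hsub EventuallyEq.rfl).add hTO
  refine ⟨ε, fun N _ => (add_sub_cancel _ _).symm, ?_, E₁, E₂, hE, hE₁, hE₂⟩
  have := (hE₁.trans_tendsto hlim).add (hE₂.trans_tendsto hR')
  rw [add_zero] at this
  exact this.congr fun N => (hE N).symm
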